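/- **Corollary (Lagrangian Feynman formula for a mixture of multiplicative and additive perturbations of Feller semigroups).** Let $C_\infty=C_\infty(\mathbb R^d)$ be the Banach space of continuous functions $\mathbb R^d\to\mathbb C$ vanishing at infinity, with the supremum norm, and $C^1_\infty\subset C_\infty$ the space of continuously differentiable functions that vanish at infinity together with their first derivatives. Let $H:\mathbb R^d\times\mathbb R^d\to\mathbb C$ be measurable and locally bounded, such that for every $q$ the function $H(q,\cdot)$ is continuous negative definite, i.e. it has a Lévy–Khintchine representation $$H(q,p)=k+i\ell\cdot p+p\cdot Qp+\int_{y\ne0}\Big(1-e^{iy\cdot p}+\frac{iy\cdot p}{1+|y|^2}\Big)N(dy)$$ with $k\ge 0$, $\ell\in\mathbb R^d$, a positive semidefinite symmetric matrix $Q$ and a measure $N$ on $\mathbb R^d\setminus\{0\}$ with $\int\frac{|y|^2}{1+|y|^2}N(dy)<\infty$ (all depending on $q$). For a symbol $h$ let $h(\cdot,D)$ be the operator with domain in $C_c^\infty(\mathbb R^d)$, $$h(q,D)\varphi(q)=(2\pi)^{-d/2}\int e^{ip\cdot q}h(q,p)\widehat\varphi(p)\,dp,\qquad \widehat\varphi(p)=(2\pi)^{-d/2}\int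 e^{-ip\cdot q}\varphi(q)\,dq .$$ Assume that $H(\cdot,D)$ maps $C_c^\infty(\mathbb R^d)$ into $C_\infty$ and that $-H(\cdot,D)$ generates a Feller semigroup $(T_t)_{t\ge0}$, that is, a strongly continuous positivity preserving contraction semigroup on $C_\infty$ whose generator extends $-H(\cdot,D)$ from $C_c^\infty(\mathbb R^d)$. Let $p_t(q,dy)$ be its transition kernels, $T_t\varphi(q)=\int\varphi(y)\,p_t(q,dy)$, with $p_t(q,\mathbb R^d)\le 1$. Let $c>0$, let $a:\mathbb R^d\to[c,1/c]$ be continuous, and let $b:\mathbb R^d\to\mathbb R^d$ and $V:\mathbb R^d\to\mathbb R$ be bounded and continuous. Put $\widetilde H(q,p)=a(q)H(q,p)$ and define on $C_\infty$, for $t\ge0$, $$\widetilde F(t)\varphi(q)=(T_{a(q)t}\varphi)(q),\qquad S(t)\varphi(q)=\varphi(q+t\,b(q)),\qquad (e^{tV}\varphi)(q)=e^{tV(q)}\varphi(q).$$ Assume that $-\widetilde H(\cdot,D)$ is closable and that its closure generates a strongly continuous semigroup on $C_\infty$. Let $\mathcal D$ be a linear subspace of $C_\infty$ (for example $\mathcal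 D=C_c^\infty(\mathbb R^d)$ or $\mathcal D=C_\infty$), and consider $$B\varphi=-\widetilde H(\cdot,D)\varphi+b\cdot\nabla\varphi+V\varphi$$ for those $\varphi\in\mathcal D\cap C^1_\infty$ that lie in the domain of the closure of $-\widetilde H(\cdot,D)$ (here $-\widetilde H(\cdot,D)$ denotes that closure). Assume that $B$ is closable and that its closure is the generator of a strongly continuous semigroup $(\widetilde T^B_t)_{t\ge0}$ on $C_\infty$. Then for every $\varphi\in C_\infty$ $$\widetilde T^B_t\varphi=\lim_{n\to\infty}\big[e^{\frac tnV}\circ S(\tfrac tn)\circ\widetilde F(\tfrac tn)\big]^n\varphi$$ in $C_\infty$, uniformly for $t$ in bounded intervals of $[0,\infty)$, and $$\widetilde T^B_t\varphi(q_0)=\lim_{n\to\infty}\int_{\mathbb R^d}\!\cdots\!\int_{\mathbb R^d}e^{\frac tn\sum_{k=1}^nV(q_{k-1})}\varphi(q_n)\,p_{a(x_0)\frac tn}(x_0,dq_1)\,p_{a(x_1)\frac tn}(x_1,dq_2)\cdots p_{a(x_{n-1})\frac tn}(x_{n-1},dq_n),$$ where $x_k=q_k+b(q_k)\frac tn$ and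 the integral is the iterated one (over $q_n$ first), uniformly in $q_0\in\mathbb R^d$ and in $t$ in bounded intervals of $[0,\infty)$. -/

import Mathlib

open MeasureTheory ProbabilityTheory Filter Topology
open scoped NNReal ZeroAtInfty BoundedContinuousFunction ContDiff ComplexOrder

noncomputable section

namespace FeynmanFormula

/-- The state space `ℝ^d` with its Euclidean norm. -/
abbrev Space (d : ℕ) : Type := EuclideanSpace ℝ (Fin d)

/-- The Banach space `C_∞(ℝ^d)` of complex continuous functions vanishing at infinity, with the
supremum norm. -/
abbrev CInf (d : ℕ) : Type := C₀(Space d, ℂ)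

/-! ### Strongly continuous semigroups and their generators -/

/-- A strongly continuous (`C₀`-) semigroup of bounded operators on a complex Banach space. -/
structure C0Semigroup (X : Type*) [NormedAddCommGroup X] [NormedSpace ℂ X] where
  /-- the operator at time `t ≥ 0` -/
  op : ℝ≥0 → X →L[ℂ] X
  op_zero : op 0 = ContinuousLinearMap.id ℂ X
  op_add : ∀ s t, op (s + t) = (op s).comp (op t)
  strong_cont : ∀ f, Continuous fun t => op t f

section Generator

variable {X : Type*} [NormedAddCommGroup X] [NormedSpace ℂ X]

/-- The graph of the generator: all pairs `(f, g)` with `(T_t f - f) / t → g` in norm as `t ↓ 0`. -/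
def C0Semigroup.generatorGraph (T : C0Semigroup X) : Submodule ℂ (X × X) where
  carrier := {x | Tendsto (fun t : ℝ≥0 => (t : ℝ)⁻¹ • (T.op t x.1 - x.1)) (𝓝[>] 0) (𝓝 x.2)}
  zero_mem' := by simp
  add_mem' := by
    intro x y hx hy
    refine (hx.add hy).congr fun t => ?_
    simp only [Prod.fst_add, map_add, ← smul_add]
    congr 1
    abel
  smul_mem' := by
    intro c x hx
    refine (hx.const_smul c).congr fun t => ?_
    simp only [Prod.smul_fst, map_smul, ← smul_sub]
    rw [smul_comm]

/-- The infinitesimal generator, as an unbounded operator with its full domain. -/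
def C0Semigroup.generator (T : C0Semigroup X) : X →ₗ.[ℂ] X := T.generatorGraph.toLinearPMap

theorem C0Semigroup.generator_graph (T : C0Semigroup X) :
    T.generator.graph = T.generatorGraph := by
  refine Submodule.toLinearPMap_graph_eq _ fun x hx h0 => ?_
  have h : Tendsto (fun t : ℝ≥0 => (t : ℝ)⁻¹ • (T.op t x.1 - x.1)) (𝓝[>] 0) (𝓝 x.2) := hx
  simp only [h0, map_zero, sub_zero, smul_zero] at h
  exact tendsto_nhds_unique h tendsto_const_nhds

/-- The operator `A` is closable and its closure is the generator of the semigroup `T`. -/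
def ClosureGenerates (A : X →ₗ.[ℂ] X) (T : C0Semigroup X) : Prop :=
  A.IsClosable ∧ A.closure = T.generator

end Generator

/-- A Feller semigroup on `ℝ^d`: a strongly continuous positivity preserving contraction
semigroup on `C_∞(ℝ^d)`. -/
structure FellerSemigroup (d : ℕ) extends C0Semigroup (CInf d) where
  contraction : ∀ t, ‖op t‖ ≤ 1
  positive : ∀ t (f : CInf d), (∀ q, 0 ≤ f q) → ∀ q, 0 ≤ op t f q

/-- `p_t(q, dy)` is the transition kernel of the Feller semigroup:
it has total mass at most one and `T_t φ(q) = ∫ φ(y) p_t(q, dy)`. -/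
def IsTransitionKernel {d : ℕ} (T : FellerSemigroup d) (p : ℝ≥0 → Kernel (Space d) (Space d)) :
    Prop :=
  (∀ t q, p t q Set.univ ≤ 1) ∧ ∀ t (f : CInf d) q, T.op t f q = ∫ y, f y ∂(p t q)

/-! ### Symbols and pseudo-differential operators -/

/-- `ψ` is a continuous negative definite function, i.e. it has a Lévy–Khintchine representation
with characteristics `(k, ℓ, Q, N)`. -/
def IsLevyKhintchine {d : ℕ} (ψ : Space d → ℂ) : Prop :=
  ∃ (k : ℝ) (l : Space d) (Q : Matrix (Fin d) (Fin d) ℝ) (N : Measure (Space d)),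
    0 ≤ k ∧ Q.PosSemidef ∧ N {0} = 0 ∧
    (∫⁻ y, ENNReal.ofReal (‖y‖ ^ 2 / (1 + ‖y‖ ^ 2)) ∂N) < ⊤ ∧
    ∀ p : Space d, ψ p = (k : ℂ) + Complex.I * (inner ℝ l p : ℝ)
      + ((p.ofLp ⬝ᵥ (Q.mulVec p.ofLp) : ℝ) : ℂ)
      + ∫ y, (1 - Complex.exp (Complex.I * (inner ℝ y p : ℝ))
          + Complex.I * (inner ℝ y p : ℝ) / ((1 + ‖y‖ ^ 2 : ℝ) : ℂ)) ∂N

/-- A negative definite symbol: measurable, locally bounded, and continuous negative definite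
in the co-variable `p`. -/
structure IsNegativeDefiniteSymbol {d : ℕ} (H : Space d → Space d → ℂ) : Prop where
  measurable : Measurable (Function.uncurry H)
  locally_bounded : ∀ R : ℝ, ∃ C : ℝ, ∀ q p, ‖q‖ ≤ R → ‖p‖ ≤ R → ‖H q p‖ ≤ C
  levyKhintchine : ∀ q, IsLevyKhintchine (H q)

/-- The space `C_c^∞(ℝ^d)` of test functions, inside `C_∞(ℝ^d)`. -/
def testFunctions (d : ℕ) : Submodule ℂ (CInf d) where
  carrier := {f | ContDiff ℝ ∞ (f : Space d → ℂ) ∧ HasCompactSupport (f : Space d → ℂ)}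
  zero_mem' := ⟨contDiff_const, HasCompactSupport.zero⟩
  add_mem' := fun hf hg => ⟨hf.1.add hg.1, hf.2.add hg.2⟩
  smul_mem' := fun c _ hf => ⟨contDiff_const.smul hf.1, hf.2.smul_left (f := fun _ => c)⟩

/-- The Fourier transform `(2π)^{-d/2} ∫ e^{-i p·q} f(q) dq`. -/
def fourier {d : ℕ} (f : CInf d) (p : Space d) : ℂ :=
  (((2 * Real.pi) ^ (-(d : ℝ) / 2) : ℝ) : ℂ) *
    ∫ q, Complex.exp (-(Complex.I * (inner ℝ p q : ℝ))) * f q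

/-- The integrand `e^{i p·q} H(q, p) f̂(p)` of a pseudo-differential operator. -/
def psiIntegrand {d : ℕ} (H : Space d → Space d → ℂ) (f : CInf d) (q p : Space d) : ℂ :=
  Complex.exp (Complex.I * (inner ℝ p q : ℝ)) * H q p * fourier f p

theorem integrable_fourier_aux {d : ℕ} {f : CInf d} (hf : f ∈ testFunctions d) (p : Space d) :
    Integrable fun q => Complex.exp (-(Complex.I * (inner ℝ p q : ℝ))) * f q := by
  refine Continuous.integrable_of_hasCompactSupport (by fun_prop) ?_
  exact HasCompactSupport.mul_left (f := fun q : Space d =>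
    Complex.exp (-(Complex.I * (inner ℝ p q : ℝ)))) hf.2

theorem fourier_add {d : ℕ} {f g : CInf d} (hf : f ∈ testFunctions d) (hg : g ∈ testFunctions d)
    (p : Space d) : fourier (f + g) p = fourier f p + fourier g p := by
  simp only [fourier, ← mul_add]
  rw [← integral_add (integrable_fourier_aux hf p) (integrable_fourier_aux hg p)]
  simp [mul_add]

theorem fourier_smul {d : ℕ} (c : ℂ) (f : CInf d) (p : Space d) :
    fourier (c • f) p = c * fourier f p := by
  simp only [fourier, ZeroAtInftyContinuousMap.smul_apply, smul_eq_mul, mul_left_comm _ c,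
    integral_const_mul]

/-- The graph of `H(·,D)` on test functions: all pairs `(f, g)` with `f ∈ C_c^∞`, `g ∈ C_∞` and
`g(q) = (2π)^{-d/2} ∫ e^{i p·q} H(q,p) f̂(p) dp` for all `q`, where the integral converges. -/
def psiDOGraph {d : ℕ} (H : Space d → Space d → ℂ) : Submodule ℂ (CInf d × CInf d) where
  carrier := {x | x.1 ∈ testFunctions d ∧ ∀ q, Integrable (psiIntegrand H x.1 q) ∧
    x.2 q = (((2 * Real.pi) ^ (-(d : ℝ) / 2) : ℝ) : ℂ) * ∫ p, psiIntegrand H x.1 q p}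
  zero_mem' := by
    have h : ∀ q, psiIntegrand H (0 : CInf d) q = fun _ => 0 := by
      intro q; funext p; simp [psiIntegrand, fourier]
    exact ⟨zero_mem _, fun q => by simp [h]⟩
  add_mem' := by
    rintro x y ⟨hx, hx'⟩ ⟨hy, hy'⟩
    have h : ∀ q, psiIntegrand H (x + y).1 q
        = fun p => psiIntegrand H x.1 q p + psiIntegrand H y.1 q p := by
      intro q; funext p; simp [psiIntegrand, fourier_add hx hy, mul_add]
    refine ⟨add_mem hx hy, fun q => ?_⟩
    rw [h]
    refine ⟨(hx' q).1.add (hy' q).1, ?_⟩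
    rw [integral_add (hx' q).1 (hy' q).1, mul_add, ← (hx' q).2, ← (hy' q).2]
    rfl
  smul_mem' := by
    rintro c x ⟨hx, hx'⟩
    have h : ∀ q, psiIntegrand H (c • x).1 q = fun p => c * psiIntegrand H x.1 q p := by
      intro q; funext p; simp [psiIntegrand, fourier_smul, mul_left_comm c]
    refine ⟨Submodule.smul_mem _ c hx, fun q => ?_⟩
    rw [h]
    refine ⟨(hx' q).1.const_mul c, ?_⟩
    rw [integral_const_mul, mul_left_comm, ← (hx' q).2]
    rfl

/-- The pseudo-differential operator `H(·,D)` in `C_∞(ℝ^d)`, on those test functions which it maps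
into `C_∞(ℝ^d)`. -/
def psiDO {d : ℕ} (H : Space d → Space d → ℂ) : CInf d →ₗ.[ℂ] CInf d :=
  (psiDOGraph H).toLinearPMap

theorem psiDO_graph {d : ℕ} (H : Space d → Space d → ℂ) : (psiDO H).graph = psiDOGraph H := by
  refine Submodule.toLinearPMap_graph_eq _ fun x hx h0 => ?_
  ext q
  have h : psiIntegrand H x.1 q = fun _ => 0 := by
    funext p; simp [psiIntegrand, fourier, h0]
  rw [(hx.2 q).2, h]
  simp

/-- The symbol `H̃(q,p) = a(q) H(q,p)`. -/
def mulSymbol {d : ℕ} (a : Space d →ᵇ ℝ≥0) (H : Space d → Space d → ℂ) (q p : Space d) : ℂ :=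
  (a q : ℂ) * H q p

/-! ### The operators entering the formula -/

/-- Multiplication by a bounded continuous function. -/
def mulOp {d : ℕ} (m : Space d →ᵇ ℂ) : CInf d →L[ℂ] CInf d :=
  LinearMap.mkContinuous
    { toFun := fun f =>
        { toFun := fun q => m q * f q
          continuous_toFun := m.continuous.mul (map_continuous f)
          zero_at_infty' := by
            have h : Tendsto (fun q => ‖m‖ * ‖f q‖) (cocompact (Space d)) (𝓝 0) := by
              simpa using (zero_at_infty f).norm.const_mul ‖m‖
            refine squeeze_zero_norm (fun q => ?_) h
            rw [norm_mul]
            exact mul_le_mul_of_nonneg_right (m.norm_coe_le_norm q) (norm_nonneg _) }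
      map_add' := fun f g => by ext q; exact mul_add _ _ _
      map_smul' := fun c f => by ext q; exact mul_left_comm _ _ _ }
    ‖m‖ (fun f => by
      rw [← ZeroAtInftyContinuousMap.norm_toBCF_eq_norm]
      refine (BoundedContinuousFunction.norm_le (by positivity)).2 fun q => ?_
      change ‖m q * f q‖ ≤ _
      rw [norm_mul]
      exact mul_le_mul (m.norm_coe_le_norm q) (f.toBCF.norm_coe_le_norm q) (norm_nonneg _)
        (norm_nonneg _))

/-- `V` as a bounded continuous complex function. -/
def potential {d : ℕ} (V : Space d →ᵇ ℝ) : Space d →ᵇ ℂ :=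
  BoundedContinuousFunction.ofNormedAddCommGroup (fun q => (V q : ℂ))
    (Complex.continuous_ofReal.comp V.continuous) ‖V‖
    (fun q => by simpa using V.norm_coe_le_norm q)

/-- The bounded continuous function `e^{tV}`. -/
def expPotential {d : ℕ} (V : Space d →ᵇ ℝ) (t : ℝ≥0) : Space d →ᵇ ℂ :=
  BoundedContinuousFunction.ofNormedAddCommGroup (fun q => Complex.exp ((t : ℂ) * (V q : ℂ)))
    (Complex.continuous_exp.comp
      (continuous_const.mul (Complex.continuous_ofReal.comp V.continuous)))
    (Real.exp (t * ‖V‖))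
    (fun q => by
      rw [Complex.norm_exp]
      refine Real.exp_le_exp.2 ?_
      have h : ((t : ℂ) * (V q : ℂ)).re = t * V q := by simp
      rw [h]
      exact mul_le_mul_of_nonneg_left ((le_abs_self _).trans (V.norm_coe_le_norm q)) t.2)

/-- The operator `e^{tV}` of multiplication by the function `e^{tV}`. -/
def expOp {d : ℕ} (V : Space d →ᵇ ℝ) (t : ℝ≥0) : CInf d →L[ℂ] CInf d := mulOp (expPotential V t)

/-- The shift operator `S(t)`, `S(t)φ(q) = φ(q + t b(q))`. -/
def shiftOp {d : ℕ} (b : Space d →ᵇ Space d) (t : ℝ≥0) : CInf d →L[ℂ] CInf d :=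
  LinearMap.mkContinuous
    { toFun := fun f =>
        { toFun := fun q => f (q + (t : ℝ) • b q)
          continuous_toFun := (map_continuous f).comp
            (continuous_id.add (b.continuous.const_smul (t : ℝ)))
          zero_at_infty' := by
            refine (zero_at_infty f).comp ?_
            rw [← Metric.cobounded_eq_cocompact, ← tendsto_norm_atTop_iff_cobounded]
            have h : Tendsto (fun q : Space d => ‖q‖ + -(t * ‖b‖)) (Bornology.cobounded _) atTop :=
              tendsto_atTop_add_const_right _ _ tendsto_norm_cobounded_atTop
            refine tendsto_atTop_mono (fun q => ?_) h
            have h1 : ‖q‖ ≤ ‖q + (t : ℝ) • b q‖ + ‖(t : ℝ) • b q‖ := by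
              simpa using norm_sub_le (q + (t : ℝ) • b q) ((t : ℝ) • b q)
            have h2 : ‖(t : ℝ) • b q‖ ≤ t * ‖b‖ := by
              rw [norm_smul, Real.norm_of_nonneg (show (0 : ℝ) ≤ (t : ℝ) from t.2)]
              exact mul_le_mul_of_nonneg_left (b.norm_coe_le_norm q) t.2
            linarith }
      map_add' := fun f g => by ext q; rfl
      map_smul' := fun c f => by ext q; rfl }
    1 (fun f => by
      rw [one_mul, ← ZeroAtInftyContinuousMap.norm_toBCF_eq_norm]
      refine (BoundedContinuousFunction.norm_le (by positivity)).2 fun q => ?_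
      exact f.toBCF.norm_coe_le_norm (q + (t : ℝ) • b q))

theorem norm_apply_le {d : ℕ} (f : CInf d) (q : Space d) : ‖f q‖ ≤ ‖f‖ :=
  f.toBCF.norm_coe_le_norm q

theorem norm_op_le {d : ℕ} (T : FellerSemigroup d) (t : ℝ≥0) (f : CInf d) : ‖T.op t f‖ ≤ ‖f‖ := by
  simpa using (T.op t).le_of_opNorm_le (T.contraction t) f

theorem continuous_timeChange {d : ℕ} (T : FellerSemigroup d) (a : Space d →ᵇ ℝ≥0) (t : ℝ≥0)
    (f : CInf d) : Continuous fun q => T.op (a q * t) f q := by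
  rw [continuous_iff_continuousAt]
  intro q₀
  have h1 : Tendsto (fun q => T.op (a q * t) f - T.op (a q₀ * t) f) (𝓝 q₀) (𝓝 0) := by
    have h : Continuous fun q => T.op (a q * t) f - T.op (a q₀ * t) f :=
      ((T.strong_cont f).comp (a.continuous.mul continuous_const)).sub continuous_const
    simpa using h.tendsto q₀
  have h2 : Tendsto (fun q => (T.op (a q * t) f - T.op (a q₀ * t) f) q) (𝓝 q₀) (𝓝 0) :=
    squeeze_zero_norm (fun q => norm_apply_le _ q) (by simpa using h1.norm)
  have h3 := h2.add ((map_continuous (T.op (a q₀ * t) f)).tendsto q₀)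
  simpa [ContinuousAt] using h3

theorem zero_at_infty_timeChange {d : ℕ} (T : FellerSemigroup d) (a : Space d →ᵇ ℝ≥0) (t : ℝ≥0)
    (f : CInf d) : Tendsto (fun q => T.op (a q * t) f q) (cocompact (Space d)) (𝓝 0) := by
  rw [Metric.tendsto_nhds]
  intro ε hε
  obtain ⟨M, hM⟩ : ∃ M : ℝ≥0, ∀ q, a q ≤ M := by
    obtain ⟨C, hC⟩ := a.bounded
    refine ⟨a 0 + C.toNNReal, fun q => ?_⟩
    have h : (a q : ℝ) - a 0 ≤ C := (le_abs_self _).trans (hC q 0)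
    have h' : (a q : ℝ) ≤ a 0 + C := by linarith
    rw [← NNReal.coe_le_coe, NNReal.coe_add]
    exact h'.trans (by gcongr; exact Real.le_coe_toNNReal C)
  have hK : IsCompact ((fun s => T.op s f) '' Set.Icc 0 (M * t)) :=
    isCompact_Icc.image (T.strong_cont f)
  obtain ⟨F, hF, hcov⟩ := Metric.totallyBounded_iff.1 hK.totallyBounded (ε / 2) (half_pos hε)
  have hev : ∀ᶠ q in cocompact (Space d), ∀ g ∈ F, ‖g q‖ < ε / 2 := by
    refine (Filter.eventually_all_finite hF).2 fun g _ => ?_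
    have h : Tendsto (fun q => ‖g q‖) (cocompact (Space d)) (𝓝 0) := by
      simpa using (zero_at_infty g).norm
    exact h.eventually_lt_const (half_pos hε)
  filter_upwards [hev] with q hq
  have hmem : T.op (a q * t) f ∈ (fun s => T.op s f) '' Set.Icc 0 (M * t) :=
    ⟨a q * t, ⟨zero_le, mul_le_mul_left (hM q) t⟩, rfl⟩
  obtain ⟨g, hg, hgd⟩ := Set.mem_iUnion₂.1 (hcov hmem)
  have h1 : ‖T.op (a q * t) f q - g q‖ < ε / 2 :=
    (norm_apply_le (T.op (a q * t) f - g) q).trans_lt (by simpa [dist_eq_norm] using hgd)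
  have h2 : ‖T.op (a q * t) f q‖ ≤ ‖T.op (a q * t) f q - g q‖ + ‖g q‖ := by
    simpa using norm_add_le (T.op (a q * t) f q - g q) (g q)
  rw [dist_zero_right]
  linarith [hq g hg]

/-- The operator `F̃(t)`, `F̃(t)φ(q) = (T_{a(q)t} φ)(q)`. -/
def timeChangeOp {d : ℕ} (T : FellerSemigroup d) (a : Space d →ᵇ ℝ≥0) (t : ℝ≥0) :
    CInf d →L[ℂ] CInf d :=
  LinearMap.mkContinuous
    { toFun := fun f =>
        { toFun := fun q => T.op (a q * t) f q
          continuous_toFun := continuous_timeChange T a t f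
          zero_at_infty' := zero_at_infty_timeChange T a t f }
      map_add' := fun f g => by ext q; simp
      map_smul' := fun c f => by ext q; simp }
    1 (fun f => by
      rw [one_mul, ← ZeroAtInftyContinuousMap.norm_toBCF_eq_norm]
      refine (BoundedContinuousFunction.norm_le (by positivity)).2 fun q => ?_
      exact (norm_apply_le (T.op (a q * t) f) q).trans (norm_op_le T _ f))

/-- The space `C^1_∞(ℝ^d)` of continuously differentiable functions which vanish at infinity
together with their first derivatives. -/
def contDiffInf (d : ℕ) : Submodule ℂ (CInf d) where
  carrier := {f | ContDiff ℝ 1 (f : Space d → ℂ) ∧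
    Tendsto (fderiv ℝ (f : Space d → ℂ)) (cocompact (Space d)) (𝓝 0)}
  zero_mem' := by
    refine ⟨contDiff_const, ?_⟩
    have h : fderiv ℝ (⇑(0 : CInf d)) = fun _ => 0 := by
      funext q
      exact fderiv_const_apply (0 : ℂ)
    rw [h]
    exact tendsto_const_nhds
  add_mem' := by
    rintro f g ⟨hf, hf'⟩ ⟨hg, hg'⟩
    refine ⟨hf.add hg, ?_⟩
    have h : fderiv ℝ (⇑(f + g)) = fun q => fderiv ℝ f q + fderiv ℝ g q := by
      funext q
      exact fderiv_add (hf.differentiable one_ne_zero q) (hg.differentiable one_ne_zero q)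
    rw [h]
    simpa using hf'.add hg'
  smul_mem' := by
    rintro c f ⟨hf, hf'⟩
    refine ⟨contDiff_const.smul hf, ?_⟩
    have h : fderiv ℝ (⇑(c • f)) = fun q => c • fderiv ℝ f q := by
      funext q
      exact fderiv_const_smul (hf.differentiable one_ne_zero q) c
    rw [h]
    refine (hf'.const_smul c).trans (le_of_eq (congrArg 𝓝 ?_))
    ext v
    simp

/-- The first-order operator `b∇`, `(b∇)φ(q) = b(q)·∇φ(q)`, with domain `C^1_∞(ℝ^d)`. -/
def gradOp {d : ℕ} (b : Space d →ᵇ Space d) : CInf d →ₗ.[ℂ] CInf d where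
  domain := contDiffInf d
  toFun :=
    { toFun := fun f =>
        { toFun := fun q => fderiv ℝ (f : CInf d) q (b q)
          continuous_toFun := (f.2.1.continuous_fderiv one_ne_zero).clm_apply b.continuous
          zero_at_infty' := by
            have h : Tendsto (fun q => ‖fderiv ℝ (f : CInf d) q‖ * ‖b‖) (cocompact (Space d))
                (𝓝 0) := by
              simpa using f.2.2.norm.mul_const ‖b‖
            refine squeeze_zero_norm (fun q => ?_) h
            exact (ContinuousLinearMap.le_opNorm _ _).trans
              (mul_le_mul_of_nonneg_left (b.norm_coe_le_norm q) (norm_nonneg _)) }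
      map_add' := fun f g => by
        ext q
        exact congrArg (fun L => L (b q)) (fderiv_add (f.2.1.differentiable one_ne_zero q)
          (g.2.1.differentiable one_ne_zero q))
      map_smul' := fun c f => by
        ext q
        exact congrArg (fun L => L (b q)) (fderiv_const_smul
          (f.2.1.differentiable one_ne_zero q) c) }

/-- The operator `B = -H̃(·,D) + b∇ + V`, where `-H̃(·,D)` stands for its closure, with the natural
domain `D(-H̃(·,D)) ∩ D(b∇)`. -/
def perturbedOp {d : ℕ} (Ht : Space d → Space d → ℂ) (b : Space d →ᵇ Space d)
    (V : Space d →ᵇ ℝ) : CInf d →ₗ.[ℂ] CInf d :=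
  (-psiDO Ht).closure + gradOp b + (mulOp (potential V)).toLinearMap.toPMap ⊤

/-- One step `e^{tV} ∘ S(t) ∘ F̃(t)` of the formula. -/
def stepOp {d : ℕ} (T : FellerSemigroup d) (a : Space d →ᵇ ℝ≥0) (b : Space d →ᵇ Space d)
    (V : Space d →ᵇ ℝ) (t : ℝ≥0) : CInf d →L[ℂ] CInf d :=
  (expOp V t).comp ((shiftOp b t).comp (timeChangeOp T a t))

/-- The `n`-fold iterated integral
`∫ κ(q₀, dq₁) ∫ κ(q₁, dq₂) ⋯ ∫ κ(q_{n-1}, dq_n) G(q₀, q₁, …, q_n)`. -/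
def iteratedIntegral {E : Type*} [MeasurableSpace E] (κ : E → Measure E) :
    (n : ℕ) → ((Fin (n + 1) → E) → ℂ) → E → ℂ
  | 0, G, q₀ => G (fun _ => q₀)
  | n + 1, G, q₀ =>
      ∫ q₁, iteratedIntegral κ n (fun path => G (Fin.cons q₀ path : Fin (n + 2) → E)) q₁ ∂(κ q₀)

/-- The measure `p_{a(x)τ}(x, dy)` at the shifted point `x = q + b(q)τ`. -/
def shiftedKernel {d : ℕ} (p : ℝ≥0 → Kernel (Space d) (Space d)) (a : Space d →ᵇ ℝ≥0)
    (b : Space d →ᵇ Space d) (τ : ℝ≥0) (q : Space d) : Measure (Space d) :=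
  p (a (q + (τ : ℝ) • b q) * τ) (q + (τ : ℝ) • b q)

/-- The approximation
`∫⋯∫ e^{(t/n) ∑_{k=1}^n V(q_{k-1})} φ(q_n) p_{a(x₀)t/n}(x₀, dq₁) ⋯ p_{a(x_{n-1})t/n}(x_{n-1}, dq_n)`
with `x_k = q_k + b(q_k) t/n`. -/
def lagrangianIntegral {d : ℕ} (p : ℝ≥0 → Kernel (Space d) (Space d)) (a : Space d →ᵇ ℝ≥0)
    (b : Space d →ᵇ Space d) (V : Space d →ᵇ ℝ) (f : CInf d) (t : ℝ≥0) (n : ℕ) (q₀ : Space d) :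
    ℂ :=
  iteratedIntegral (shiftedKernel p a b (t / n)) n
    (fun q => Complex.exp (((t / n : ℝ≥0) : ℂ) * ∑ k : Fin n, (V (q k.castSucc) : ℂ))
      * f (q (Fin.last n))) q₀

end FeynmanFormula

end

open FeynmanFormula

/-! This is Chernoff's product formula for the family F(t) = e^{tV} S(t) F̃(t), with ‖F(t)‖ ≤
e^{t‖V‖}.

Consistency: F(t) has derivative Bφ at t = 0 for every φ in the domain of the unrestricted B, by the
product rule (`consistentOn_stepOp`). The delicate term is F̃: its derivative is a·Aφ for φ in the
domain of the generator A of T, whereas B contains the closure of -(aH)(·,D). Since 1/a is bounded,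
division by a is a bounded operator, and so the closure of -(aH)(·,D) lies inside a·A
(`exists_mem_of_mem_closure_graph`).

Chernoff (`ConsistentOn.tendstoUniformlyOn_pow`): the argument uses no resolvents; it is stability
plus consistency. An orbit of the limit semigroup that starts in the domain of its generator is
approximated by a sequence v with F(h)v_k = v_{k+1} up to εh (`ConsistentOn.exists_discrete_orbit`).
The errors telescope over the n steps to a multiple of ε.

The integral formula follows because the iterated integral is F(t/n)^n φ evaluated at q₀. -/

namespace FeynmanFormula

/-! ### Strongly continuous semigroups: local boundedness, closedness and density of the generator.
-/

section Semigroup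

variable {X : Type*} [NormedAddCommGroup X] [NormedSpace ℂ X]

theorem C0Semigroup.mem_generatorGraph {T : C0Semigroup X} {x : X × X} :
    x ∈ T.generatorGraph ↔
      Tendsto (fun t : ℝ≥0 => (t : ℝ)⁻¹ • (T.op t x.1 - x.1)) (𝓝[>] 0) (𝓝 x.2) :=
  Iff.rfl

theorem C0Semigroup.op_add_apply (T : C0Semigroup X) (s t : ℝ≥0) (f : X) :
    T.op (s + t) f = T.op s (T.op t f) := by
  rw [T.op_add]; rfl

theorem C0Semigroup.op_zero_apply (T : C0Semigroup X) (f : X) : T.op 0 f = f := by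
  rw [T.op_zero]; rfl

/-- A strongly continuous semigroup is uniformly bounded on bounded time intervals. -/
theorem C0Semigroup.exists_norm_op_le [CompleteSpace X] (T : C0Semigroup X) (t₁ : ℝ≥0) :
    ∃ L : ℝ, 0 ≤ L ∧ ∀ s ≤ t₁, ‖T.op s‖ ≤ L := by
  obtain ⟨C, hC⟩ := banach_steinhaus (g := fun s : Set.Icc 0 t₁ => T.op s) (fun f => by
    obtain ⟨C, hC⟩ := (isCompact_Icc (a := 0) (b := t₁)).exists_bound_of_continuousOn
      (T.strong_cont f).continuousOn
    exact ⟨C, fun s => hC s s.2⟩)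
  exact ⟨C, (norm_nonneg _).trans (hC ⟨0, by simp⟩), fun s hs => hC ⟨s, ⟨zero_le, hs⟩⟩⟩

theorem tendsto_toNNReal_sub_nhdsGT (s : ℝ) :
    Tendsto (fun y => (y - s).toNNReal) (𝓝[>] s) (𝓝[>] 0) := by
  refine tendsto_nhdsWithin_iff.2 ⟨?_, ?_⟩
  · have h : Continuous fun y : ℝ => (y - s).toNNReal := by fun_prop
    simpa using (h.tendsto s).mono_left nhdsWithin_le_nhds
  · filter_upwards [self_mem_nhdsWithin] with y hy
    simpa using hy

/-- The orbit of an element of the domain of the generator has the expected right derivative. -/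
theorem C0Semigroup.hasDerivWithinAt_orbit (T : C0Semigroup X) {x : X × X}
    (hx : x ∈ T.generatorGraph) {s : ℝ} (hs : 0 ≤ s) :
    HasDerivWithinAt (fun r : ℝ => T.op r.toNNReal x.1) (T.op s.toNNReal x.2) (Set.Ici s) s := by
  rw [← hasDerivWithinAt_Ioi_iff_Ici, hasDerivWithinAt_iff_tendsto_slope' (by simp)]
  have h := ((T.op s.toNNReal).continuous.tendsto _).comp
    ((C0Semigroup.mem_generatorGraph.1 hx).comp (tendsto_toNNReal_sub_nhdsGT s))
  refine h.congr' ?_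
  filter_upwards [self_mem_nhdsWithin] with y hy
  have hy : s < y := hy
  have e : y.toNNReal = s.toNNReal + (y - s).toNNReal := by
    rw [← Real.toNNReal_add hs (by linarith)]; congr 1; ring
  simp only [Function.comp, slope, vsub_eq_sub]
  rw [e, T.op_add_apply, Real.coe_toNNReal _ (by linarith : 0 ≤ y - s),
    ContinuousLinearMap.map_smul_of_tower, map_sub]

/-- Mean value estimate along an orbit of the semigroup. -/
theorem C0Semigroup.norm_op_sub_sub_smul_le (T : C0Semigroup X) {x : X × X}
    (hx : x ∈ T.generatorGraph) (w : X) {C : ℝ} {t : ℝ≥0} (hC : ∀ s ≤ t, ‖T.op s x.2 - w‖ ≤ C) :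
    ‖T.op t x.1 - x.1 - (t : ℝ) • w‖ ≤ C * t := by
  have h := norm_image_sub_le_of_norm_deriv_right_le_segment
    (f := fun r : ℝ => T.op r.toNNReal x.1 - r • w) (a := 0) (b := t)
    (f' := fun r : ℝ => T.op r.toNNReal x.2 - w) (C := C)
    (((T.strong_cont x.1).comp continuous_real_toNNReal).sub
      (continuous_id.smul continuous_const)).continuousOn
    (fun s hs => (T.hasDerivWithinAt_orbit hx hs.1).sub
      (by simpa using ((hasDerivAt_id s).smul_const w).hasDerivWithinAt))
    (fun s hs => hC _ (Real.toNNReal_le_iff_le_coe.2 hs.2.le)) t ⟨t.2, le_rfl⟩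
  simpa [T.op_zero_apply, sub_right_comm] using h

/-- The generator of a strongly continuous semigroup is closed. -/
theorem C0Semigroup.isClosed_generatorGraph [CompleteSpace X] (T : C0Semigroup X) :
    IsClosed (T.generatorGraph : Set (X × X)) := by
  refine isClosed_of_closure_subset fun x hx => ?_
  obtain ⟨L, hL0, hL⟩ := T.exists_norm_op_le 1
  refine C0Semigroup.mem_generatorGraph.2 (Metric.tendsto_nhds.2 fun ε hε => ?_)
  have hcont : ∀ᶠ t : ℝ≥0 in 𝓝 0, ‖T.op t x.2 - x.2‖ < ε / 2 := by
    have h : Tendsto (fun t => ‖T.op t x.2 - x.2‖) (𝓝 0) (𝓝 0) := by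
      simpa [T.op_zero_apply] using
        (((T.strong_cont x.2).sub (continuous_const (y := x.2))).norm.tendsto 0)
    exact h.eventually_lt_const (half_pos hε)
  obtain ⟨δ, hδ, hδ'⟩ := Metric.eventually_nhds_iff.1 hcont
  have h1 : ∀ᶠ t : ℝ≥0 in 𝓝 0, t < 1 := gt_mem_nhds one_pos
  have h2 : ∀ᶠ t : ℝ≥0 in 𝓝 0, dist t 0 < δ := Metric.ball_mem_nhds _ hδ
  filter_upwards [self_mem_nhdsWithin, nhdsWithin_le_nhds h1, nhdsWithin_le_nhds h2]
    with t ht ht1 htδ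
  have ht : 0 < (t : ℝ) := ht
  have key : ‖T.op t x.1 - x.1 - (t : ℝ) • x.2‖ ≤ ε / 2 * t := by
    -- For fixed `t` this estimate is a closed condition on `y`, and it holds on the graph; at the
    -- limit point `x` the term with `L` vanishes.
    have hcl : IsClosed {y : X × X | ‖T.op t y.1 - y.1 - (t : ℝ) • x.2‖ ≤
        (L * ‖y.2 - x.2‖ + ε / 2) * t} := by
      refine isClosed_le ?_ ?_ <;> fun_prop
    have hsub : (T.generatorGraph : Set (X × X)) ⊆ {y : X × X |
        ‖T.op t y.1 - y.1 - (t : ℝ) • x.2‖ ≤ (L * ‖y.2 - x.2‖ + ε / 2) * t} := by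
      intro y hy
      refine T.norm_op_sub_sub_smul_le hy x.2 fun s hs => ?_
      have e : T.op s y.2 - x.2 = T.op s (y.2 - x.2) + (T.op s x.2 - x.2) := by
        rw [map_sub]; abel
      rw [e]
      refine (norm_add_le _ _).trans (add_le_add ?_ (hδ' ?_).le)
      · exact (T.op s).le_of_opNorm_le (hL s (hs.trans ht1.le)) _
      · refine lt_of_le_of_lt ?_ htδ
        simpa [NNReal.dist_eq] using hs
    simpa using closure_minimal hsub hcl hx
  rw [dist_eq_norm]
  have e : (t : ℝ)⁻¹ • (T.op t x.1 - x.1) - x.2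
      = (t : ℝ)⁻¹ • (T.op t x.1 - x.1 - (t : ℝ) • x.2) := by
    rw [smul_sub _ _ ((t : ℝ) • x.2), inv_smul_smul₀ ht.ne']
  rw [e, norm_smul, norm_inv, Real.norm_of_nonneg ht.le, inv_mul_lt_iff₀ ht]
  nlinarith

/-- The domain of the generator of a strongly continuous semigroup is dense. -/
theorem C0Semigroup.mem_closure_domain [CompleteSpace X] (T : C0Semigroup X) (f : X) :
    f ∈ closure (Prod.fst '' (T.generatorGraph : Set (X × X))) := by
  set φ : ℝ → X := fun r => T.op r.toNNReal f with hφ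
  have hc : Continuous φ := (T.strong_cont f).comp continuous_real_toNNReal
  have hI : ∀ a b, IntervalIntegrable φ volume a b := fun a b => hc.intervalIntegrable a b
  have hd : ∀ r, HasDerivAt (fun y => ∫ s in (0 : ℝ)..y, φ s) (φ r) r := fun r =>
    intervalIntegral.integral_hasDerivAt_right (hI _ _)
      (hc.stronglyMeasurableAtFilter _ _) hc.continuousAt
  -- Integrals of an orbit lie in the domain, and their averages over [0, t] tend to `f`. The
  -- operator at time h shifts the interval of integration by h, so the difference quotient is one
  -- of the integral function.
  have hmem : ∀ t : ℝ, 0 ≤ t → (∫ s in (0 : ℝ)..t, φ s, φ t - φ 0) ∈ T.generatorGraph := by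
    intro t ht
    have hK : HasDerivAt (fun h => (∫ s in (0 : ℝ)..(t + h), φ s) - ∫ s in (0 : ℝ)..h, φ s)
        (φ t - φ 0) 0 := by
      refine HasDerivAt.sub ?_ (hd 0)
      have := (hd (t + 0)).comp_const_add t 0
      simpa using this
    have h1 := (hasDerivWithinAt_iff_tendsto_slope' (by simp)).1
      (hK.hasDerivWithinAt (s := Set.Ioi 0))
    have hcoe : Tendsto (fun h : ℝ≥0 => (h : ℝ)) (𝓝[>] 0) (𝓝[>] 0) := by
      refine tendsto_nhdsWithin_iff.2 ⟨?_, ?_⟩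
      · simpa using (NNReal.continuous_coe.tendsto 0).mono_left nhdsWithin_le_nhds
      · filter_upwards [self_mem_nhdsWithin] with y hy
        simpa using hy
    refine (h1.comp hcoe).congr' ?_
    filter_upwards [self_mem_nhdsWithin] with h hh
    have e1 : T.op h (∫ s in (0 : ℝ)..t, φ s) = ∫ s in (h : ℝ)..(t + h), φ s := by
      rw [← ContinuousLinearMap.intervalIntegral_comp_comm _ (hI _ _)]
      have e2 : ∫ s in (0 : ℝ)..t, φ (s + h) = ∫ s in (0 + h : ℝ)..(t + h), φ s :=
        intervalIntegral.integral_comp_add_right _ _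
      rw [zero_add] at e2
      rw [← e2]
      refine intervalIntegral.integral_congr fun s hs => ?_
      rw [Set.uIcc_of_le ht] at hs
      simp only [hφ]
      rw [Real.toNNReal_add hs.1 h.coe_nonneg, Real.toNNReal_coe, add_comm s.toNNReal,
        T.op_add_apply]
    simp only [Function.comp, slope, vsub_eq_sub, sub_zero, add_zero,
      intervalIntegral.integral_same]
    rw [e1, intervalIntegral.integral_interval_sub_left (hI _ _) (hI _ _)]
  have h1 := (hasDerivWithinAt_iff_tendsto_slope' (by simp)).1
    ((hd 0).hasDerivWithinAt (s := Set.Ioi 0))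
  have h0 : φ 0 = f := by simp [hφ, T.op_zero_apply]
  rw [h0] at h1
  refine mem_closure_of_tendsto h1 ?_
  filter_upwards [self_mem_nhdsWithin] with t ht
  refine ⟨_, T.generatorGraph.smul_mem ((t⁻¹ : ℝ) : ℂ) (hmem t (le_of_lt ht)), ?_⟩
  simp only [Prod.smul_fst, slope, vsub_eq_sub, sub_zero, intervalIntegral.integral_same]
  exact Complex.coe_smul _ _

end Semigroup

/-! ### Chernoff's product formula by stability and consistency. -/

section Chernoff

variable {X : Type*} [NormedAddCommGroup X] [NormedSpace ℂ X]

/-- Stability and consistency imply convergence: an approximate orbit stays close to an orbit. -/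
theorem norm_pow_apply_sub_le (L : X →L[ℂ] X) {M C : ℝ} (n : ℕ) (v : ℕ → X)
    (hM : ∀ k ≤ n, ‖L ^ k‖ ≤ M) (h : ∀ k < n, ‖L (v k) - v (k + 1)‖ ≤ C) :
    ‖(L ^ n) (v 0) - v n‖ ≤ n * (M * C) := by
  induction n generalizing v with
  | zero => simp
  | succ n ih =>
    have h1 := ih (fun k => v (k + 1)) (fun k hk => hM k (by omega))
      (fun k hk => h (k + 1) (by omega))
    -- The first step is split off, and induction applies to the shifted sequence.
    have e : (L ^ (n + 1)) (v 0) - v (n + 1)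
        = (L ^ n) (L (v 0) - v 1) + ((L ^ n) (v 1) - v (n + 1)) := by
      rw [pow_succ, map_sub]
      change (L ^ n) (L (v 0)) - _ = _
      abel
    rw [e]
    have h2 : ‖(L ^ n) (L (v 0) - v 1)‖ ≤ M * C :=
      (ContinuousLinearMap.le_opNorm _ _).trans
        (mul_le_mul (hM n (by omega)) (h 0 (by omega)) (norm_nonneg _)
          ((norm_nonneg _).trans (hM 0 (by omega))))
    refine (norm_add_le _ _).trans ((add_le_add h2 h1).trans (le_of_eq ?_))
    push_cast
    ring

/-- `(F(t) f - f) / t → g` as `t ↓ 0` for all `(f, g)` in `G`. -/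
def ConsistentOn (F : ℝ≥0 → X →L[ℂ] X) (G : Set (X × X)) : Prop :=
  ∀ x ∈ G, Tendsto (fun t : ℝ≥0 => (t : ℝ)⁻¹ • (F t x.1 - x.1)) (𝓝[>] 0) (𝓝 x.2)

variable {F : ℝ≥0 → X →L[ℂ] X} {G : Set (X × X)} {T : C0Semigroup X}

theorem C0Semigroup.op_mem_generatorGraph {x : X × X} (hx : x ∈ T.generatorGraph) (s : ℝ≥0) :
    (T.op s x.1, T.op s x.2) ∈ T.generatorGraph := by
  refine (((T.op s).continuous.tendsto _).comp (C0Semigroup.mem_generatorGraph.1 hx)).congr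
    fun t => ?_
  simp only [Function.comp]
  rw [ContinuousLinearMap.map_smul_of_tower, map_sub, ← T.op_add_apply, ← T.op_add_apply,
    add_comm]

/-- The orbit of the pair `x` stays in the graph, hence in the closure of `G`, where consistency can
be used approximately. By continuity one element of `G` serves all times near a given one, so
compactness of [0, t₁] yields a single step threshold `h₀`. -/
theorem ConsistentOn.exists_approx_orbit (hF : ConsistentOn F G)
    (hG : (T.generatorGraph : Set (X × X)) ⊆ closure G) {x : X × X} (hx : x ∈ T.generatorGraph)
    (t₁ : ℝ≥0) {η : ℝ} (hη : 0 < η) :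
    ∃ h₀ : ℝ≥0, 0 < h₀ ∧ ∃ y : ℝ≥0 → X, ∀ s ≤ t₁, ‖y s - T.op s x.1‖ ≤ η ∧
      ∀ h : ℝ≥0, 0 < h → h < h₀ → ‖(h : ℝ)⁻¹ • (F h (y s) - y s) - T.op s x.2‖ ≤ η := by
  suffices H : ∃ h₀ : ℝ≥0, 0 < h₀ ∧ ∀ s ∈ Set.Icc 0 t₁, ∃ y : X, ‖y - T.op s x.1‖ ≤ η ∧
      ∀ h : ℝ≥0, 0 < h → h < h₀ → ‖(h : ℝ)⁻¹ • (F h y - y) - T.op s x.2‖ ≤ η by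
    obtain ⟨h₀, hpos, H⟩ := H
    choose! y hy using H
    exact ⟨h₀, hpos, y, fun s hs => hy s ⟨zero_le, hs⟩⟩
  refine (isCompact_Icc (a := 0) (b := t₁)).induction_on (p := fun S => ∃ h₀ : ℝ≥0, 0 < h₀ ∧
    ∀ s ∈ S, ∃ y : X, ‖y - T.op s x.1‖ ≤ η ∧
      ∀ h : ℝ≥0, 0 < h → h < h₀ → ‖(h : ℝ)⁻¹ • (F h y - y) - T.op s x.2‖ ≤ η)
    ⟨1, one_pos, by simp⟩ ?_ ?_ ?_
  · rintro S S' hS ⟨h₀, hpos, H⟩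
    exact ⟨h₀, hpos, fun s hs => H s (hS hs)⟩
  · rintro S S' ⟨h₀, hpos, H⟩ ⟨h₁, hpos', H'⟩
    refine ⟨min h₀ h₁, lt_min hpos hpos', ?_⟩
    rintro s (hs | hs)
    · obtain ⟨y, hy, hy'⟩ := H s hs
      exact ⟨y, hy, fun h h1 h2 => hy' h h1 (h2.trans_le (min_le_left _ _))⟩
    · obtain ⟨y, hy, hy'⟩ := H' s hs
      exact ⟨y, hy, fun h h1 h2 => hy' h h1 (h2.trans_le (min_le_right _ _))⟩
  · intro s hs
    obtain ⟨z, hzG, hz⟩ := Metric.mem_closure_iff.1 (hG (T.op_mem_generatorGraph hx s)) (η / 3)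
      (by positivity)
    have hz1 : dist (T.op s x.1) z.1 < η / 3 := (le_max_left _ _).trans_lt hz
    have hz2 : dist (T.op s x.2) z.2 < η / 3 := (le_max_right _ _).trans_lt hz
    have hev := Metric.tendsto_nhds.1 (hF z hzG) (η / 3) (by positivity)
    obtain ⟨h₀, hpos, hh⟩ := (mem_nhdsGT_iff_exists_Ioo_subset).1 hev
    have c1 : ∀ᶠ r in 𝓝 s, dist (T.op r x.1) (T.op s x.1) < η / 3 :=
      Metric.tendsto_nhds.1 ((T.strong_cont x.1).tendsto s) _ (by positivity)
    have c2 : ∀ᶠ r in 𝓝 s, dist (T.op r x.2) (T.op s x.2) < η / 3 :=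
      Metric.tendsto_nhds.1 ((T.strong_cont x.2).tendsto s) _ (by positivity)
    refine ⟨_, nhdsWithin_le_nhds (c1.and c2), h₀, hpos, fun r hr => ⟨z.1, ?_, fun h h1 h2 => ?_⟩⟩
    · rw [← dist_eq_norm, dist_comm]
      linarith [dist_triangle (T.op r x.1) (T.op s x.1) z.1, hr.1]
    · have h3 : dist ((h : ℝ)⁻¹ • (F h z.1 - z.1)) z.2 < η / 3 := hh ⟨h1, h2⟩
      rw [← dist_eq_norm]
      have h4 := dist_triangle4 ((h : ℝ)⁻¹ • (F h z.1 - z.1)) z.2 (T.op s x.2) (T.op r x.2)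
      rw [dist_comm z.2, dist_comm (T.op s x.2) (T.op r x.2)] at h4
      linarith [hr.2]

/-- Piecewise linear interpolation with `m` steps between consecutive nodes `y 0, y 1, …`. -/
noncomputable def interpolate (y : ℕ → X) (m k : ℕ) : X :=
  y (k / m) + ((k % m : ℕ) / (m : ℝ)) • (y (k / m + 1) - y (k / m))

theorem interpolate_succ_sub (y : ℕ → X) {m : ℕ} (hm : 0 < m) (k : ℕ) :
    interpolate y m (k + 1) - interpolate y m k = (m : ℝ)⁻¹ • (y (k / m + 1) - y (k / m)) := by
  have hm' : (m : ℝ) ≠ 0 := by positivity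
  have hlt := Nat.mod_lt k hm
  have hk := Nat.mod_add_div k m
  -- Either `k + 1` stays in the same block, or it is the next node, where the weight wraps from
  -- (m-1)/m to 0.
  rcases Nat.lt_or_ge (k % m + 1) m with h | h
  · obtain ⟨h1, h2⟩ := (Nat.div_mod_unique (a := k + 1) (c := k % m + 1) (d := k / m) hm).2
      ⟨by omega, h⟩
    simp only [interpolate, h1, h2]
    push_cast
    module
  · have e : k % m + 1 = m := by omega
    obtain ⟨h1, h2⟩ := (Nat.div_mod_unique (a := k + 1) (c := 0) (d := k / m + 1) hm).2
      ⟨by rw [mul_add]; omega, hm⟩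
    simp only [interpolate, h1, h2]
    have e' : ((k % m : ℕ) : ℝ) = m - 1 := by
      rw [eq_sub_iff_add_eq]; exact_mod_cast e
    rw [e', sub_div, div_self hm']
    simp only [Nat.cast_zero, zero_div, zero_smul, sub_smul, one_smul, one_div]
    abel

theorem norm_convexComb_sub_le {θ C : ℝ} (h0 : 0 ≤ θ) (h1 : θ ≤ 1) {u v w : X} (hu : ‖u - w‖ ≤ C)
    (hv : ‖v - w‖ ≤ C) : ‖u + θ • (v - u) - w‖ ≤ C := by
  have e : u + θ • (v - u) - w = (1 - θ) • (u - w) + θ • (v - w) := by module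
  rw [e]
  refine (norm_add_le _ _).trans ?_
  rw [norm_smul, norm_smul, Real.norm_of_nonneg h0, Real.norm_of_nonneg (sub_nonneg.2 h1)]
  nlinarith

theorem C0Semigroup.exists_modulus (T : C0Semigroup X) {x : X × X} (hx : x ∈ T.generatorGraph)
    {ε : ℝ} (hε : 0 < ε) : ∃ δ : ℝ≥0, 0 < δ ∧ δ ≤ 1 ∧ ∀ s : ℝ≥0, s ≤ δ →
      (0 < s → ‖(s : ℝ)⁻¹ • (T.op s x.1 - x.1) - x.2‖ ≤ ε) ∧ ‖T.op s x.2 - x.2‖ ≤ ε ∧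
        ‖T.op s x.1 - x.1‖ ≤ ε := by
  have c : ∀ u : X, ∀ᶠ s : ℝ≥0 in 𝓝 0, ‖T.op s u - u‖ ≤ ε := fun u => by
    have h : Tendsto (fun t => ‖T.op t u - u‖) (𝓝 0) (𝓝 0) := by
      simpa [T.op_zero_apply] using
        (((T.strong_cont u).sub (continuous_const (y := u))).norm.tendsto 0)
    exact h.eventually_le_const hε
  have c0 : ∀ᶠ s : ℝ≥0 in 𝓝[>] 0, ‖(s : ℝ)⁻¹ • (T.op s x.1 - x.1) - x.2‖ ≤ ε := by
    have := Metric.tendsto_nhds.1 (C0Semigroup.mem_generatorGraph.1 hx) ε hε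
    filter_upwards [this] with s hs
    rw [← dist_eq_norm]; exact hs.le
  have c1 := eventually_nhdsWithin_iff.1 c0
  obtain ⟨r, hr, hr'⟩ := Metric.eventually_nhds_iff.1 (c1.and ((c x.2).and (c x.1)))
  -- Half of `r` turns the strict inequality into a non-strict one; the cap at 1 keeps later blocks
  -- inside [0, t₁ + 1].
  refine ⟨min 1 (r / 2).toNNReal, lt_min one_pos (by simpa using hr), min_le_left _ _,
    fun s hs => hr' ?_⟩
  have h2 := hs.trans (min_le_right _ _)
  rw [Real.le_toNNReal_iff_coe_le (by positivity)] at h2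
  rw [NNReal.dist_eq]
  simp only [NNReal.coe_zero, sub_zero, NNReal.abs_eq]
  linarith

/-- The defect of one step along an interpolated segment is h times the difference of two
approximations of the same vector `w`: the interpolated difference quotients of `L`, and the slope
of the segment. -/
theorem map_convexComb_sub (L : X →L[ℂ] X) {h Δ θ : ℝ} (hh : h ≠ 0) (y z w : X) :
    L (y + θ • (z - y)) - ((h * Δ⁻¹) • (z - y) + (y + θ • (z - y)))
      = h • ((h⁻¹ • (L y - y) + θ • (h⁻¹ • (L z - z) - h⁻¹ • (L y - y)) - w)
          - (Δ⁻¹ • (z - y) - w)) := by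
  rw [map_add, ContinuousLinearMap.map_smul_of_tower, map_sub]
  simp only [smul_sub, smul_add, smul_comm h θ, smul_inv_smul₀ hh, mul_smul]
  abel

theorem norm_diffQuotient_sub_le {Δ η C : ℝ} (hΔ : 0 < Δ) {y z u v w : X} (hy : ‖y - u‖ ≤ η)
    (hz : ‖z - v‖ ≤ η) (h : ‖Δ⁻¹ • (v - u) - w‖ ≤ C) :
    ‖Δ⁻¹ • (z - y) - w‖ ≤ 2 * η / Δ + C := by
  have e : Δ⁻¹ • (z - y) - w = Δ⁻¹ • ((z - v) - (y - u)) + (Δ⁻¹ • (v - u) - w) := by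
    simp only [smul_sub]; abel
  rw [e]
  refine (norm_add_le _ _).trans (add_le_add ?_ h)
  rw [norm_smul, norm_inv, Real.norm_of_nonneg hΔ.le, inv_mul_le_iff₀ hΔ,
    mul_div_cancel₀ _ hΔ.ne']
  linarith [norm_sub_le (z - v) (y - u)]

/-- Choosing an approximant afresh at each time kh would fail: its error η does not shrink with h,
while the defect must be at most εh. So approximants are chosen only at nodes a distance Δ apart,
with Δ comparable to a fixed δ, and joined linearly; the slope error is then 2η/Δ, small by the
choice of η. -/
theorem ConsistentOn.exists_discrete_orbit [CompleteSpace X] (hF : ConsistentOn F G)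
    (hG : (T.generatorGraph : Set (X × X)) ⊆ closure G) {x : X × X} (hx : x ∈ T.generatorGraph)
    (t₁ : ℝ≥0) {ε : ℝ} (hε : 0 < ε) :
    ∃ h₀ : ℝ≥0, 0 < h₀ ∧ ∀ h : ℝ≥0, 0 < h → h < h₀ → ∃ v : ℕ → X, ∀ k : ℕ, k * h ≤ t₁ →
      ‖v k - T.op (k * h) x.1‖ ≤ ε ∧ ‖F h (v k) - v (k + 1)‖ ≤ ε * h := by
  obtain ⟨L, hL0, hL⟩ := T.exists_norm_op_le (t₁ + 1)
  set ε' : ℝ := ε / (2 * (1 + L)) with hε'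
  have hε0 : 0 < ε' := by positivity
  have hεε : ε = 2 * (1 + L) * ε' := by rw [hε']; field_simp
  obtain ⟨δ, hδ0, hδ1, hδ⟩ := T.exists_modulus hx hε0
  have hδ0' : 0 < (δ : ℝ) := hδ0
  obtain ⟨h₀, hh₀, y, hy⟩ := hF.exists_approx_orbit hG hx (t₁ + 1)
    (η := min ε' (ε' * δ / 4)) (by positivity)
  -- With h < δ/2, rounding δ down to a multiple of h leaves a block longer than δ/2.
  refine ⟨min h₀ (δ / 2), lt_min hh₀ (by positivity), fun h hpos hlt => ?_⟩
  have hpos' : 0 < (h : ℝ) := hpos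
  have hlt1 := hlt.trans_le (min_le_left _ _)
  have hlt2 : (h : ℝ) < δ / 2 := by
    have := hlt.trans_le (min_le_right _ _)
    exact_mod_cast this
  -- the number of steps in a block
  set m : ℕ := ⌊(δ / h : ℝ≥0)⌋₊ with hm_def
  have hm1 : (m : ℝ≥0) * h ≤ δ := by
    rw [← le_div_iff₀ hpos]; exact Nat.floor_le zero_le
  have hm2 : (δ : ℝ) < (m + 1) * h := by
    have : δ / h < (m : ℝ≥0) + 1 := Nat.lt_floor_add_one _
    rw [div_lt_iff₀ hpos] at this
    exact_mod_cast this
  set Δ : ℝ≥0 := m * h with hΔ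
  have hΔc : (Δ : ℝ) = m * h := by rw [hΔ]; push_cast; rfl
  have hΔ2 : (δ : ℝ) / 2 < Δ := by rw [hΔc]; linarith
  have hΔ0 : 0 < (Δ : ℝ) := by linarith
  have hΔ1 : Δ ≤ 1 := hm1.trans hδ1
  have hm : 0 < m := by
    rcases Nat.eq_zero_or_pos m with h | h
    · simp [hΔc, h] at hΔ0
    · exact h
  have hm' : 0 < (m : ℝ) := by exact_mod_cast hm
  refine ⟨interpolate (fun j => y (j * Δ)) m, fun k hk => ?_⟩
  set j := k / m with hj
  set i := k % m with hi
  have him : i < m := Nat.mod_lt _ hm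
  have hkij : i + m * j = k := Nat.mod_add_div k m
  set s : ℝ≥0 := j * Δ with hs
  have hs' : ((j + 1 : ℕ) : ℝ≥0) * Δ = s + Δ := by push_cast; rw [add_mul, one_mul]
  set r : ℝ≥0 := i * h with hr
  have hkh : (k : ℝ≥0) * h = s + r := by
    rw [← hkij, hs, hr, hΔ]; push_cast; ring
  obtain ⟨r', hr'⟩ : ∃ r', r + r' = Δ := by
    refine ⟨((m - i : ℕ) : ℝ≥0) * h, ?_⟩
    rw [hr, hΔ, ← add_mul]; norm_cast; congr 2; omega
  have hrΔ : r ≤ Δ := by rw [← hr']; exact le_self_add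
  have hr'Δ : r' ≤ Δ := by rw [← hr']; exact le_add_self
  have hsr1 : s + r ≤ t₁ + 1 := by rw [← hkh]; exact hk.trans le_self_add
  have hs1 : s ≤ t₁ + 1 := le_self_add.trans hsr1
  -- The right node of the last block may lie beyond `t₁`, by at most 1.
  have hsΔ1 : s + Δ ≤ t₁ + 1 :=
    add_le_add ((le_self_add (a := s) (b := r)).trans (hkh ▸ hk)) hΔ1
  have hLε : 0 ≤ L * ε' := by positivity
  have hη1 := min_le_left ε' (ε' * δ / 4)
  have hη2 := min_le_right ε' (ε' * δ / 4)
  obtain ⟨ys, ys'⟩ := hy s hs1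
  obtain ⟨yt, yt'⟩ := hy (s + Δ) hsΔ1
  have hLT : ∀ q ≤ t₁ + 1, ∀ u : X, ‖u‖ ≤ ε' → ‖T.op q u‖ ≤ L * ε' := fun q hq u hu =>
    ((T.op q).le_of_opNorm_le (hL q hq) u).trans (mul_le_mul_of_nonneg_left hu hL0)
  set θ : ℝ := (i : ℝ) / m with hθ
  have hθ0 : 0 ≤ θ := by positivity
  have hθ1 : θ ≤ 1 := by
    rw [hθ, div_le_one hm']; exact_mod_cast him.le
  have hv : interpolate (fun j => y (j * Δ)) m k = y s + θ • (y (s + Δ) - y s) := by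
    simp only [interpolate]
    rw [← hj, ← hi, hs']
  constructor
  · rw [hv, hkh]
    have b : ε' + L * ε' ≤ ε := by rw [hεε]; linarith
    refine norm_convexComb_sub_le hθ0 hθ1 ?_ ?_
    · have h1 := hLT s hs1 _ (hδ r (hrΔ.trans hm1)).2.2
      rw [map_sub, ← T.op_add_apply] at h1
      have h2 := norm_sub_le (y s - T.op s x.1) (T.op (s + r) x.1 - T.op s x.1)
      rw [sub_sub_sub_cancel_right] at h2
      linarith
    · have h1 := hLT (s + r) hsr1 _ (hδ r' (hr'Δ.trans hm1)).2.2
      rw [map_sub, ← T.op_add_apply, add_assoc, hr'] at h1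
      have h2 := norm_add_le (y (s + Δ) - T.op (s + Δ) x.1) (T.op (s + Δ) x.1 - T.op (s + r) x.1)
      rw [sub_add_sub_cancel] at h2
      linarith
  · have hvs := interpolate_succ_sub (fun j => y (j * Δ)) hm k
    rw [← hj, hs'] at hvs
    have e1 : (m : ℝ)⁻¹ = h * (Δ : ℝ)⁻¹ := by rw [hΔc]; field_simp
    rw [sub_eq_iff_eq_add.1 hvs, hv, e1,
      map_convexComb_sub (F h) hpos'.ne' (y s) (y (s + Δ)) (T.op s x.2), norm_smul,
      Real.norm_of_nonneg hpos'.le, mul_comm]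
    refine mul_le_mul_of_nonneg_right ?_ hpos'.le
    have b1 : ‖(h : ℝ)⁻¹ • (F h (y s) - y s)
            + θ • ((h : ℝ)⁻¹ • (F h (y (s + Δ)) - y (s + Δ)) - (h : ℝ)⁻¹ • (F h (y s) - y s))
            - T.op s x.2‖ ≤ ε' + L * ε' := by
      refine norm_convexComb_sub_le hθ0 hθ1 ?_ ?_
      · linarith [ys' h hpos hlt1]
      · have h1 := hLT s hs1 _ (hδ Δ hm1).2.1
        rw [map_sub, ← T.op_add_apply] at h1
        have h2 := norm_add_le ((h : ℝ)⁻¹ • (F h (y (s + Δ)) - y (s + Δ)) - T.op (s + Δ) x.2)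
          (T.op (s + Δ) x.2 - T.op s x.2)
        rw [sub_add_sub_cancel] at h2
        linarith [yt' h hpos hlt1]
    have b2 : ‖(Δ : ℝ)⁻¹ • (y (s + Δ) - y s) - T.op s x.2‖ ≤ ε' + L * ε' := by
      have h1 := hLT s hs1 _ ((hδ Δ hm1).1 hΔ0)
      rw [map_sub, ContinuousLinearMap.map_smul_of_tower, map_sub, ← T.op_add_apply] at h1
      refine (norm_diffQuotient_sub_le hΔ0 ys yt h1).trans (add_le_add_left ?_ _)
      rw [div_le_iff₀ hΔ0]
      -- From η ≤ ε'δ/4 and Δ > δ/2 follows 2η/Δ ≤ ε'.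
      linarith [mul_lt_mul_of_pos_left hΔ2 hε0]
    refine (norm_sub_le _ _).trans ?_
    rw [hεε]
    linarith

/-- Chernoff's product formula. -/
theorem ConsistentOn.tendstoUniformlyOn_pow [CompleteSpace X] (hF : ConsistentOn F G)
    (hG : (T.generatorGraph : Set (X × X)) ⊆ closure G) (hF0 : F 0 = 1) {β : ℝ} (hβ : 0 ≤ β)
    (hFn : ∀ t, ‖F t‖ ≤ Real.exp (t * β)) (f : X) (t₀ : ℝ≥0) :
    TendstoUniformlyOn (fun (n : ℕ) (t : ℝ≥0) => (F (t / n) ^ n) f) (fun t => T.op t f) atTop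
      (Set.Icc 0 t₀) := by
  obtain ⟨L, hL0, hL⟩ := T.exists_norm_op_le t₀
  set M : ℝ := max 1 (Real.exp (t₀ * β)) with hM
  have hM1 : 1 ≤ M := le_max_left _ _
  have hFM : ∀ (h : ℝ≥0) (k : ℕ), k * h ≤ t₀ → ‖F h ^ k‖ ≤ M := by
    intro h k hk
    -- The zeroth power is the identity, of norm at most 1 even on the trivial space.
    rcases Nat.eq_zero_or_pos k with rfl | hk0
    · rw [pow_zero]
      exact (ContinuousLinearMap.norm_id_le (𝕜 := ℂ) (E := X)).trans hM1
    · refine (norm_pow_le' _ hk0).trans ?_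
      refine (pow_le_pow_left₀ (norm_nonneg _) (hFn h) k).trans ?_
      rw [← Real.exp_nat_mul, ← mul_assoc]
      refine le_max_of_le_right (Real.exp_le_exp.2 (mul_le_mul_of_nonneg_right ?_ hβ))
      exact_mod_cast hk
  rw [Metric.tendstoUniformlyOn_iff]
  intro ε hε
  obtain ⟨_, ⟨x, hx, rfl⟩, hfx⟩ := Metric.mem_closure_iff.1 (T.mem_closure_domain f)
    (ε / (2 * (M + L + 1))) (by positivity)
  rw [dist_eq_norm] at hfx
  set ε' : ℝ := ε / (4 * (M * t₀ + M + 1)) with hε'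
  have hε0 : 0 < ε' := by positivity
  obtain ⟨h₀, hh₀, H⟩ := hF.exists_discrete_orbit hG hx t₀ hε0
  have hev : ∀ᶠ n : ℕ in atTop, (t₀ / h₀ : ℝ≥0) < n := by
    obtain ⟨N, hN⟩ := exists_nat_gt (t₀ / h₀ : ℝ≥0)
    filter_upwards [eventually_ge_atTop N] with n hn
    exact hN.trans_le (by exact_mod_cast hn)
  filter_upwards [hev] with n hn t ht
  have hn0 : (0 : ℝ≥0) < n := lt_of_le_of_lt zero_le hn
  have hlt : t / n < h₀ := by
    rw [div_lt_iff₀ hn0]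
    refine lt_of_le_of_lt ht.2 ?_
    rwa [div_lt_iff₀ hh₀, mul_comm] at hn
  have hnt : (n : ℝ≥0) * (t / n) = t := mul_div_cancel₀ _ hn0.ne'
  -- Discrete orbits exist only for positive step length; at t = 0 both sides equal `f`, as F(0) =
  -- 1.
  rcases eq_or_lt_of_le (zero_le (a := t)) with rfl | htpos
  · simp [hF0, T.op_zero_apply, hε]
  have hpos : 0 < t / n := by positivity
  obtain ⟨v, hv⟩ := H (t / n) hpos hlt
  have hkn : ∀ k ≤ n, (k : ℝ≥0) * (t / n) ≤ t₀ := fun k hk => by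
    refine le_trans ?_ (hnt.le.trans ht.2)
    gcongr
  have h1 := norm_pow_apply_sub_le (F (t / n)) (M := M) (C := ε' * (t / n : ℝ≥0)) n v
    (fun k hk => hFM _ _ (hkn k hk)) (fun k hk => (hv k (hkn k hk.le)).2)
  have h2 := (hv n (hkn n le_rfl)).1
  have h3 := (hv 0 (hkn 0 (Nat.zero_le _))).1
  rw [hnt] at h2
  simp only [Nat.cast_zero, zero_mul, T.op_zero_apply] at h3
  have hntR : (n : ℝ) * ((t / n : ℝ≥0) : ℝ) = t := by exact_mod_cast hnt
  have h1' : ‖(F (t / n) ^ n) (v 0) - v n‖ ≤ M * t₀ * ε' := by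
    refine h1.trans ?_
    have : (n : ℝ) * (M * (ε' * (t / n : ℝ≥0))) = M * t * ε' := by
      rw [← hntR]; ring
    rw [this]
    have : (t : ℝ) ≤ t₀ := by exact_mod_cast ht.2
    gcongr
  have hP := hFM (t / n) n (hkn n le_rfl)
  have h4 : ‖(F (t / n) ^ n) (f - x.1)‖ ≤ M * ‖f - x.1‖ :=
    ContinuousLinearMap.le_of_opNorm_le _ hP _
  have h5 : ‖(F (t / n) ^ n) (v 0 - x.1)‖ ≤ M * ε' :=
    (ContinuousLinearMap.le_of_opNorm_le _ hP _).trans (by gcongr)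
  have h6 : ‖T.op t (f - x.1)‖ ≤ L * ‖f - x.1‖ :=
    ContinuousLinearMap.le_of_opNorm_le _ (hL t ht.2) _
  have hA : (M + L) * ‖f - x.1‖ ≤ ε / 2 := by
    have h7 : (M + L + 1) * ‖f - x.1‖ ≤ ε / 2 := by
      rw [lt_div_iff₀ (by positivity)] at hfx
      linarith
    nlinarith [norm_nonneg (f - x.1)]
  have hB : (M * t₀ + M + 1) * ε' = ε / 4 := by rw [hε']; field_simp
  -- The errors come from replacing `f` by `x.1` (below ε/2), and from the starting value, the
  -- accumulated defects and the final value of `v` (together at most ε/4).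
  have e : T.op t f - (F (t / n) ^ n) f = T.op t (f - x.1) - (F (t / n) ^ n) (f - x.1)
      + (F (t / n) ^ n) (v 0 - x.1) - ((F (t / n) ^ n) (v 0) - v n) - (v n - T.op t x.1) := by
    simp only [map_sub]; abel
  rw [dist_eq_norm, e]
  have n1 := norm_sub_le (T.op t (f - x.1) - (F (t / n) ^ n) (f - x.1)
      + (F (t / n) ^ n) (v 0 - x.1) - ((F (t / n) ^ n) (v 0) - v n)) (v n - T.op t x.1)
  have n2 := norm_sub_le (T.op t (f - x.1) - (F (t / n) ^ n) (f - x.1)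
      + (F (t / n) ^ n) (v 0 - x.1)) ((F (t / n) ^ n) (v 0) - v n)
  have n3 := norm_add_le (T.op t (f - x.1) - (F (t / n) ^ n) (f - x.1))
    ((F (t / n) ^ n) (v 0 - x.1))
  have n4 := norm_sub_le (T.op t (f - x.1)) ((F (t / n) ^ n) (f - x.1))
  linarith

end Chernoff

/-! ### Derivatives at time zero of the three factors and of their product. -/

section Consistency

variable {d : ℕ}

theorem norm_le_of_forall {f : CInf d} {C : ℝ} (hC : 0 ≤ C) (h : ∀ q, ‖f q‖ ≤ C) : ‖f‖ ≤ C := by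
  rw [← ZeroAtInftyContinuousMap.norm_toBCF_eq_norm]
  exact (BoundedContinuousFunction.norm_le hC).2 h

theorem tendsto_diffQuotient {X : Type*} [NormedAddCommGroup X] [NormedSpace ℂ X] {u : ℝ≥0 → X}
    {x y : X} (h : ∀ ε > 0, ∀ᶠ t : ℝ≥0 in 𝓝[>] 0, ‖u t - x - (t : ℝ) • y‖ ≤ ε * t) :
    Tendsto (fun t : ℝ≥0 => (t : ℝ)⁻¹ • (u t - x)) (𝓝[>] 0) (𝓝 y) := by
  refine Metric.tendsto_nhds.2 fun ε hε => ?_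
  filter_upwards [h (ε / 2) (half_pos hε), self_mem_nhdsWithin] with t ht ht0
  have ht0 : 0 < (t : ℝ) := ht0
  have e : (t : ℝ)⁻¹ • (u t - x) - y = (t : ℝ)⁻¹ • (u t - x - (t : ℝ) • y) := by
    rw [smul_sub _ _ ((t : ℝ) • y), inv_smul_smul₀ ht0.ne']
  rw [dist_eq_norm, e, norm_smul, norm_inv, Real.norm_of_nonneg ht0.le, inv_mul_lt_iff₀ ht0]
  nlinarith

theorem eventually_norm_sub_sub_le {X : Type*} [NormedAddCommGroup X] [NormedSpace ℂ X]
    {u : ℝ≥0 → X} {x y : X}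
    (h : Tendsto (fun t : ℝ≥0 => (t : ℝ)⁻¹ • (u t - x)) (𝓝[>] 0) (𝓝 y)) {ε : ℝ} (hε : 0 < ε) :
    ∀ᶠ t : ℝ≥0 in 𝓝[>] 0, ‖u t - x - (t : ℝ) • y‖ ≤ ε * t := by
  filter_upwards [Metric.tendsto_nhds.1 h ε hε, self_mem_nhdsWithin] with t ht ht0
  have ht0 : 0 < (t : ℝ) := ht0
  have e : u t - x - (t : ℝ) • y = (t : ℝ) • ((t : ℝ)⁻¹ • (u t - x) - y) := by
    rw [smul_sub (t : ℝ), smul_inv_smul₀ ht0.ne']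
  rw [dist_eq_norm] at ht
  rw [e, norm_smul, Real.norm_of_nonneg ht0.le, mul_comm]
  exact mul_le_mul_of_nonneg_right ht.le ht0.le

theorem tendsto_of_tendsto_diffQuotient {X : Type*} [NormedAddCommGroup X] [NormedSpace ℂ X]
    {u : ℝ≥0 → X} {x y : X}
    (h : Tendsto (fun t : ℝ≥0 => (t : ℝ)⁻¹ • (u t - x)) (𝓝[>] 0) (𝓝 y)) :
    Tendsto u (𝓝[>] 0) (𝓝 x) := by
  have hc : Tendsto (fun t : ℝ≥0 => (t : ℝ)) (𝓝[>] 0) (𝓝 0) := by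
    simpa using (NNReal.continuous_coe.tendsto 0).mono_left nhdsWithin_le_nhds
  have h1 := (hc.smul h).add_const x
  rw [zero_smul, zero_add] at h1
  refine h1.congr' ?_
  filter_upwards [self_mem_nhdsWithin] with t ht
  have ht0 : 0 < (t : ℝ) := ht
  rw [smul_inv_smul₀ ht0.ne', sub_add_cancel]

/-- A uniform norm bound makes strong convergence compatible with a moving argument; this drives the
product rule. -/
theorem tendsto_clm_apply_of_bounded {X ι : Type*} [NormedAddCommGroup X] [NormedSpace ℂ X]
    {l : Filter ι} {O : ι → X →L[ℂ] X} {C : ℝ} (hC : ∀ᶠ i in l, ‖O i‖ ≤ C) {u : ι → X} {x : X}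
    (hO : Tendsto (fun i => O i x) l (𝓝 x)) (hu : Tendsto u l (𝓝 x)) :
    Tendsto (fun i => O i (u i)) l (𝓝 x) := by
  have h0 : Tendsto (fun i => O i (u i - x)) l (𝓝 0) := by
    have h1 : Tendsto (fun i => C * ‖u i - x‖) l (𝓝 0) := by
      simpa using (tendsto_iff_norm_sub_tendsto_zero.1 hu).const_mul C
    refine squeeze_zero_norm' ?_ h1
    filter_upwards [hC] with i hi
    exact (O i).le_of_opNorm_le hi _
  simpa using h0.add hO

/-- The product rule for the derivatives at zero of operator families. -/
theorem tendsto_comp_diffQuotient {X : Type*} [NormedAddCommGroup X] [NormedSpace ℂ X]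
    {E F : ℝ≥0 → X →L[ℂ] X} {C : ℝ} {f g h : X} (hC : ∀ᶠ t in 𝓝[>] 0, ‖E t‖ ≤ C)
    (hEg : Tendsto (fun t => E t g) (𝓝[>] 0) (𝓝 g))
    (hF : Tendsto (fun t : ℝ≥0 => (t : ℝ)⁻¹ • (F t f - f)) (𝓝[>] 0) (𝓝 g))
    (hE : Tendsto (fun t : ℝ≥0 => (t : ℝ)⁻¹ • (E t f - f)) (𝓝[>] 0) (𝓝 h)) :
    Tendsto (fun t : ℝ≥0 => (t : ℝ)⁻¹ • ((E t).comp (F t) f - f)) (𝓝[>] 0) (𝓝 (g + h)) := by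
  refine ((tendsto_clm_apply_of_bounded hC hEg hF).add hE).congr fun t => ?_
  rw [ContinuousLinearMap.map_smul_of_tower, map_sub, ← smul_add, sub_add_sub_cancel]
  rfl

theorem norm_shiftOp_le (b : Space d →ᵇ Space d) (t : ℝ≥0) : ‖shiftOp b t‖ ≤ 1 :=
  LinearMap.mkContinuous_norm_le _ zero_le_one _

theorem norm_timeChangeOp_le (T : FellerSemigroup d) (a : Space d →ᵇ ℝ≥0) (t : ℝ≥0) :
    ‖timeChangeOp T a t‖ ≤ 1 :=
  LinearMap.mkContinuous_norm_le _ zero_le_one _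

theorem norm_mulOp_le (m : Space d →ᵇ ℂ) : ‖mulOp m‖ ≤ ‖m‖ :=
  LinearMap.mkContinuous_norm_le _ (norm_nonneg _) _

theorem norm_expOp_le (V : Space d →ᵇ ℝ) (t : ℝ≥0) : ‖expOp V t‖ ≤ Real.exp (t * ‖V‖) :=
  (norm_mulOp_le _).trans
    (BoundedContinuousFunction.norm_ofNormedAddCommGroup_le _ (Real.exp_nonneg _) _)

theorem norm_stepOp_le (T : FellerSemigroup d) (a : Space d →ᵇ ℝ≥0) (b : Space d →ᵇ Space d)
    (V : Space d →ᵇ ℝ) (t : ℝ≥0) : ‖stepOp T a b V t‖ ≤ Real.exp (t * ‖V‖) := by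
  have h : ‖(shiftOp b t).comp (timeChangeOp T a t)‖ ≤ 1 := by
    simpa using (ContinuousLinearMap.opNorm_comp_le _ _).trans
      (mul_le_mul (norm_shiftOp_le b t) (norm_timeChangeOp_le T a t) (norm_nonneg _) zero_le_one)
  exact (ContinuousLinearMap.opNorm_comp_le _ _).trans
    ((mul_le_mul (norm_expOp_le V t) h (ContinuousLinearMap.opNorm_nonneg _)
      (Real.exp_nonneg _)).trans_eq (mul_one _))

theorem expOp_apply (V : Space d →ᵇ ℝ) (t : ℝ≥0) (f : CInf d) (q : Space d) :
    expOp V t f q = Complex.exp ((t : ℂ) * (V q : ℂ)) * f q := rfl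

theorem shiftOp_apply (b : Space d →ᵇ Space d) (t : ℝ≥0) (f : CInf d) (q : Space d) :
    shiftOp b t f q = f (q + (t : ℝ) • b q) := rfl

theorem timeChangeOp_apply (T : FellerSemigroup d) (a : Space d →ᵇ ℝ≥0) (t : ℝ≥0) (f : CInf d)
    (q : Space d) : timeChangeOp T a t f q = T.op (a q * t) f q := rfl

theorem stepOp_apply (T : FellerSemigroup d) (a : Space d →ᵇ ℝ≥0) (b : Space d →ᵇ Space d)
    (V : Space d →ᵇ ℝ) (t : ℝ≥0) (f : CInf d) (q : Space d) :
    stepOp T a b V t f q = Complex.exp ((t : ℂ) * (V q : ℂ)) *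
      T.op (a (q + (t : ℝ) • b q) * t) f (q + (t : ℝ) • b q) := rfl

theorem stepOp_zero (T : FellerSemigroup d) (a : Space d →ᵇ ℝ≥0) (b : Space d →ᵇ Space d)
    (V : Space d →ᵇ ℝ) : stepOp T a b V 0 = 1 := by
  ext f q
  rw [stepOp_apply]
  simp [T.op_zero]

theorem smul_apply_real (r : ℝ) (f : CInf d) (q : Space d) : (r • f) q = (r : ℂ) * f q := by
  rw [ZeroAtInftyContinuousMap.smul_apply, Complex.real_smul]

/-- Boundedness of `V` makes |e^z - 1 - z| ≤ |z|² for |z| ≤ 1 uniform in q, with z = tV(q). -/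
theorem tendsto_expOp_diffQuotient (V : Space d →ᵇ ℝ) (f : CInf d) :
    Tendsto (fun t : ℝ≥0 => (t : ℝ)⁻¹ • (expOp V t f - f)) (𝓝[>] 0)
      (𝓝 (mulOp (potential V) f)) := by
  refine tendsto_diffQuotient fun ε hε => ?_
  have h1 : ∀ᶠ t : ℝ≥0 in 𝓝 0, (t : ℝ) * ‖V‖ < 1 := by
    have h : Tendsto (fun t : ℝ≥0 => (t : ℝ) * ‖V‖) (𝓝 0) (𝓝 0) := by
      have : Continuous fun t : ℝ≥0 => (t : ℝ) * ‖V‖ := by fun_prop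
      simpa using this.tendsto 0
    exact h.eventually_lt_const one_pos
  have h2 : ∀ᶠ t : ℝ≥0 in 𝓝 0, (t : ℝ) * (‖V‖ ^ 2 * ‖f‖) < ε := by
    have h : Tendsto (fun t : ℝ≥0 => (t : ℝ) * (‖V‖ ^ 2 * ‖f‖)) (𝓝 0) (𝓝 0) := by
      have : Continuous fun t : ℝ≥0 => (t : ℝ) * (‖V‖ ^ 2 * ‖f‖) := by fun_prop
      simpa using this.tendsto 0
    exact h.eventually_lt_const hε
  filter_upwards [nhdsWithin_le_nhds h1, nhdsWithin_le_nhds h2] with t ht1 ht2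
  refine norm_le_of_forall (by positivity) fun q => ?_
  have e : (expOp V t f - f - (t : ℝ) • mulOp (potential V) f) q
      = (Complex.exp ((t : ℂ) * (V q : ℂ)) - 1 - (t : ℂ) * (V q : ℂ)) * f q := by
    rw [ZeroAtInftyContinuousMap.sub_apply, ZeroAtInftyContinuousMap.sub_apply, smul_apply_real,
      expOp_apply]
    change _ - _ - (t : ℂ) * ((V q : ℂ) * f q) = _
    ring
  have hz : ‖(t : ℂ) * (V q : ℂ)‖ ≤ t * ‖V‖ := by
    rw [norm_mul, Complex.norm_real, Complex.norm_real, Real.norm_of_nonneg t.coe_nonneg]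
    exact mul_le_mul_of_nonneg_left (V.norm_coe_le_norm q) t.2
  have h3 := Complex.norm_exp_sub_one_sub_id_le (hz.trans ht1.le)
  have h4 : ‖(t : ℂ) * (V q : ℂ)‖ ^ 2 ≤ (t * ‖V‖) ^ 2 := by gcongr
  rw [e, norm_mul]
  calc _ ≤ (t * ‖V‖) ^ 2 * ‖f‖ :=
        mul_le_mul (h3.trans h4) (norm_apply_le f q) (norm_nonneg _) (by positivity)
    _ = (t * (‖V‖ ^ 2 * ‖f‖)) * t := by ring
    _ ≤ ε * t := mul_le_mul_of_nonneg_right ht2.le t.2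

theorem eventually_norm_smul_lt (b : Space d →ᵇ Space d) {δ : ℝ} (hδ : 0 < δ) :
    ∀ᶠ t : ℝ≥0 in 𝓝[>] 0, ∀ q, ‖(t : ℝ) • b q‖ < δ := by
  have h : Tendsto (fun t : ℝ≥0 => (t : ℝ) * ‖b‖) (𝓝 0) (𝓝 0) := by
    have : Continuous fun t : ℝ≥0 => (t : ℝ) * ‖b‖ := by fun_prop
    simpa using this.tendsto 0
  filter_upwards [nhdsWithin_le_nhds (h.eventually_lt_const hδ)] with t ht q
  refine lt_of_le_of_lt ?_ ht
  rw [norm_smul, Real.norm_of_nonneg t.coe_nonneg]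
  exact mul_le_mul_of_nonneg_left (b.norm_coe_le_norm q) t.2

theorem tendsto_shiftOp (b : Space d →ᵇ Space d) (f : CInf d) :
    Tendsto (fun t => shiftOp b t f) (𝓝[>] 0) (𝓝 f) := by
  refine Metric.tendsto_nhds.2 fun ε hε => ?_
  obtain ⟨δ, hδ, hf⟩ := Metric.uniformContinuous_iff.1
    (ZeroAtInftyContinuousMap.uniformContinuous f) (ε / 2) (half_pos hε)
  filter_upwards [eventually_norm_smul_lt b hδ] with t ht
  rw [dist_eq_norm]
  refine lt_of_le_of_lt (norm_le_of_forall (half_pos hε).le fun q => ?_) (half_lt_self hε)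
  rw [ZeroAtInftyContinuousMap.sub_apply, shiftOp_apply, ← dist_eq_norm]
  exact (hf (by simpa [dist_eq_norm] using ht q)).le

/-- The derivative is continuous and vanishes at infinity, hence is uniformly continuous; the mean
value inequality on a ball of radius δ around q then gives an error uniform in q. -/
theorem tendsto_shiftOp_diffQuotient (b : Space d →ᵇ Space d) (f : contDiffInf d) :
    Tendsto (fun t : ℝ≥0 => (t : ℝ)⁻¹ • (shiftOp b t (f : CInf d) - f)) (𝓝[>] 0)
      (𝓝 (gradOp b f)) := by
  refine tendsto_diffQuotient fun ε hε => ?_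
  have huc : UniformContinuous (fderiv ℝ ((f : CInf d) : Space d → ℂ)) :=
    (f.2.1.continuous_fderiv one_ne_zero).uniformContinuous_of_tendsto_cocompact f.2.2
  have hε' : 0 < ε / (‖b‖ + 1) := by positivity
  obtain ⟨δ, hδ, hf⟩ := Metric.uniformContinuous_iff.1 huc _ hε'
  filter_upwards [eventually_norm_smul_lt b hδ] with t ht
  refine norm_le_of_forall (by positivity) fun q => ?_
  have e : (shiftOp b t (f : CInf d) - f - (t : ℝ) • gradOp b f) q
      = (f : CInf d) (q + (t : ℝ) • b q) - (f : CInf d) q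
        - fderiv ℝ ((f : CInf d) : Space d → ℂ) q ((q + (t : ℝ) • b q) - q) := by
    rw [add_sub_cancel_left, map_smul, Complex.real_smul]
    rw [ZeroAtInftyContinuousMap.sub_apply, ZeroAtInftyContinuousMap.sub_apply, smul_apply_real]
    rfl
  have h := (convex_ball q δ).norm_image_sub_le_of_norm_fderiv_le' (𝕜 := ℝ)
    (f := ((f : CInf d) : Space d → ℂ)) (C := ε / (‖b‖ + 1))
    (φ := fderiv ℝ ((f : CInf d) : Space d → ℂ) q)
    (fun x _ => f.2.1.differentiable one_ne_zero x)
    (fun x hx => by rw [← dist_eq_norm]; exact (hf hx).le)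
    (Metric.mem_ball_self hδ) (y := q + (t : ℝ) • b q)
    (by simpa [dist_eq_norm] using ht q)
  rw [e]
  refine h.trans ?_
  rw [add_sub_cancel_left, norm_smul, Real.norm_of_nonneg t.coe_nonneg, div_mul_eq_mul_div,
    div_le_iff₀ (by positivity)]
  have := b.norm_coe_le_norm q
  have h0 : 0 ≤ ε * t := by positivity
  nlinarith

/-- The remainder of T_s at s = 0 is o(s) in supremum norm, so s = a(q)t may be inserted separately
at each q; a(q)t ≤ Kt keeps it o(t) uniformly. -/
theorem tendsto_timeChangeOp_diffQuotient (T : FellerSemigroup d) (a : Space d →ᵇ ℝ≥0) {K : ℝ≥0}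
    (hK : ∀ q, a q ≤ K) {x : CInf d × CInf d} (hx : x ∈ T.generatorGraph) {g : CInf d}
    (hg : ∀ q, g q = (a q : ℂ) * x.2 q) :
    Tendsto (fun t : ℝ≥0 => (t : ℝ)⁻¹ • (timeChangeOp T a t x.1 - x.1)) (𝓝[>] 0) (𝓝 g) := by
  refine tendsto_diffQuotient fun ε hε => ?_
  have hε' : 0 < ε / (K + 1) := by positivity
  have h1 := eventually_norm_sub_sub_le (C0Semigroup.mem_generatorGraph.1 hx) hε'
  -- Time s = 0 is included, since `a` may vanish in this lemma.
  have h2 : ∀ᶠ s : ℝ≥0 in 𝓝 0, ‖T.op s x.1 - x.1 - (s : ℝ) • x.2‖ ≤ ε / (K + 1) * s := by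
    filter_upwards [eventually_nhdsWithin_iff.1 h1] with s hs
    rcases eq_or_lt_of_le (zero_le (a := s)) with rfl | h
    · simp [T.op_zero]
    · exact hs h
  obtain ⟨δ, hδ, hs⟩ := Metric.eventually_nhds_iff.1 h2
  have h3 : ∀ᶠ t : ℝ≥0 in 𝓝 0, (K : ℝ) * t < δ := by
    have h : Tendsto (fun t : ℝ≥0 => (K : ℝ) * t) (𝓝 0) (𝓝 0) := by
      have : Continuous fun t : ℝ≥0 => (K : ℝ) * t := by fun_prop
      simpa using this.tendsto 0
    exact h.eventually_lt_const hδ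
  filter_upwards [nhdsWithin_le_nhds h3] with t ht
  refine norm_le_of_forall (by positivity) fun q => ?_
  have haK : (a q : ℝ) ≤ K := by exact_mod_cast hK q
  have hat : ((a q * t : ℝ≥0) : ℝ) ≤ K * t := by
    push_cast; exact mul_le_mul_of_nonneg_right haK t.2
  have h4 := hs (y := a q * t) (by
    rw [NNReal.dist_eq, NNReal.coe_zero, sub_zero, NNReal.abs_eq]; exact hat.trans_lt ht)
  have e : (timeChangeOp T a t x.1 - x.1 - (t : ℝ) • g) q
      = (T.op (a q * t) x.1 - x.1 - ((a q * t : ℝ≥0) : ℝ) • x.2) q := by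
    simp only [ZeroAtInftyContinuousMap.sub_apply, smul_apply_real, timeChangeOp_apply, hg]
    push_cast
    ring
  rw [e]
  refine (norm_apply_le _ q).trans (h4.trans ?_)
  rw [div_mul_eq_mul_div, div_le_iff₀ (by positivity)]
  have h0 : 0 ≤ ε * t := by positivity
  nlinarith

theorem tendsto_stepOp_diffQuotient {T : FellerSemigroup d} {a : Space d →ᵇ ℝ≥0}
    {b : Space d →ᵇ Space d} (V : Space d →ᵇ ℝ) {f g h : CInf d}
    (hF : Tendsto (fun t : ℝ≥0 => (t : ℝ)⁻¹ • (timeChangeOp T a t f - f)) (𝓝[>] 0) (𝓝 g))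
    (hS : Tendsto (fun t : ℝ≥0 => (t : ℝ)⁻¹ • (shiftOp b t f - f)) (𝓝[>] 0) (𝓝 h)) :
    Tendsto (fun t : ℝ≥0 => (t : ℝ)⁻¹ • (stepOp T a b V t f - f)) (𝓝[>] 0)
      (𝓝 (g + h + mulOp (potential V) f)) := by
  have hE : ∀ᶠ t : ℝ≥0 in 𝓝[>] 0, ‖expOp V t‖ ≤ Real.exp ‖V‖ := by
    have h1 : ∀ᶠ t : ℝ≥0 in 𝓝 0, t < 1 := gt_mem_nhds one_pos
    filter_upwards [nhdsWithin_le_nhds h1] with t ht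
    refine (norm_expOp_le V t).trans (Real.exp_le_exp.2 ?_)
    have ht : (t : ℝ) ≤ 1 := by exact_mod_cast ht.le
    exact mul_le_of_le_one_left (norm_nonneg _) ht
  have hE' : ∀ u : CInf d, Tendsto (fun t => expOp V t u) (𝓝[>] 0) (𝓝 u) := fun u =>
    tendsto_of_tendsto_diffQuotient (tendsto_expOp_diffQuotient V u)
  exact tendsto_comp_diffQuotient hE (hE' _)
    (tendsto_comp_diffQuotient (Eventually.of_forall fun t => norm_shiftOp_le b t)
      (tendsto_shiftOp b g) hF hS) (tendsto_expOp_diffQuotient V f)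

end Consistency

/-! ### Comparison of the operators with symbols H and aH. -/

section Symbol

variable {d : ℕ}

theorem mem_graph_neg {X : Type*} [NormedAddCommGroup X] [NormedSpace ℂ X] {A : X →ₗ.[ℂ] X}
    {x : X × X} : x ∈ (-A).graph ↔ (x.1, -x.2) ∈ A.graph := by
  rw [LinearPMap.neg_graph, Submodule.mem_map]
  constructor
  · rintro ⟨y, hy, rfl⟩
    simpa using hy
  · intro h
    exact ⟨_, h, by simp⟩

theorem apply_eq_mul_of_mem_psiDOGraph {H : Space d → Space d → ℂ} {a : Space d →ᵇ ℝ≥0}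
    {f g g' : CInf d} (hg : (f, g) ∈ psiDOGraph H) (hg' : (f, g') ∈ psiDOGraph (mulSymbol a H))
    (q : Space d) : g' q = (a q : ℂ) * g q := by
  have e : psiIntegrand (mulSymbol a H) f q = fun p => (a q : ℂ) * psiIntegrand H f q p := by
    funext p
    simp only [psiIntegrand, mulSymbol]
    ring
  have h1 := (hg.2 q).2
  have h2 := (hg'.2 q).2
  simp only at h1 h2
  rw [h2, h1, e, integral_const_mul]
  ring

/-- The closure of `-(aH)(·,D)` is contained in `a` times any closed extension of `-H(·,D)`. -/
theorem exists_mem_of_mem_closure_graph {H : Space d → Space d → ℂ}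
    (hHdom : (psiDO H).domain = testFunctions d) {A : Submodule ℂ (CInf d × CInf d)}
    (hA : IsClosed (A : Set (CInf d × CInf d))) (hHA : (-psiDO H).graph ≤ A)
    {c : ℝ≥0} (hc : 0 < c) {a : Space d →ᵇ ℝ≥0} (ha : ∀ q, c ≤ a q)
    (hcl : (-psiDO (mulSymbol a H)).IsClosable) {x : CInf d × CInf d}
    (hx : x ∈ (-psiDO (mulSymbol a H)).closure.graph) :
    ∃ g, (x.1, g) ∈ A ∧ ∀ q, x.2 q = (a q : ℂ) * g q := by
  have ha0 : ∀ q, (a q : ℂ) ≠ 0 := fun q => by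
    have := (hc.trans_le (ha q)).ne'
    exact_mod_cast this
  -- The lower bound on `a` makes 1/a a bounded multiplier, so dividing second components by `a` is
  -- continuous and pulls the closed set `A` back to a closed set.
  let r : Space d →ᵇ ℂ := BoundedContinuousFunction.ofNormedAddCommGroup (fun q => (a q : ℂ)⁻¹)
    (Continuous.inv₀ (by fun_prop) ha0) (c⁻¹ : ℝ≥0) (fun q => by
      have : ‖((a q : ℝ≥0) : ℂ)‖ = a q := by simp
      rw [norm_inv, this]
      exact_mod_cast inv_anti₀ hc (ha q))
  have hr : ∀ u q, mulOp r u q = (a q : ℂ)⁻¹ * u q := fun u q => rfl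
  refine ⟨mulOp r x.2, ?_, fun q => by rw [hr, mul_inv_cancel_left₀ (ha0 q)]⟩
  rw [← hcl.graph_closure_eq_closure_graph] at hx
  have hclosed : IsClosed {y : CInf d × CInf d | (y.1, mulOp r y.2) ∈ A} :=
    hA.preimage (f := fun y : CInf d × CInf d => (y.1, mulOp r y.2)) (by fun_prop)
  refine closure_minimal (fun y hy => ?_) hclosed hx
  have hy' : (y.1, -y.2) ∈ psiDOGraph (mulSymbol a H) := by
    rw [← psiDO_graph]; exact mem_graph_neg.1 hy
  -- Every element of the domain for aH is a test function, and H(·,D) is defined on all of these.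
  have hdom : y.1 ∈ (psiDO H).domain := by rw [hHdom]; exact hy'.1
  obtain ⟨g, hg⟩ := LinearPMap.mem_domain_iff.1 hdom
  refine hHA (mem_graph_neg.2 ?_)
  have e : -mulOp r y.2 = g := by
    ext q
    have := apply_eq_mul_of_mem_psiDOGraph ((psiDO_graph H).le hg) hy' q
    rw [ZeroAtInftyContinuousMap.neg_apply] at this ⊢
    rw [hr, ← mul_neg, this, inv_mul_cancel_left₀ (ha0 q)]
  simpa [e] using hg

end Symbol

/-! ### Iterated integrals as powers of the one-step operator. -/

section IteratedIntegral

theorem iteratedIntegral_const_mul {E : Type*} [MeasurableSpace E] (κ : E → Measure E) (n : ℕ)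
    (z : ℂ) (G : (Fin (n + 1) → E) → ℂ) (q : E) :
    iteratedIntegral κ n (fun x => z * G x) q = z * iteratedIntegral κ n G q := by
  induction n generalizing q with
  | zero => rfl
  | succ n ih =>
    simp only [iteratedIntegral, ih]
    exact integral_const_mul _ _

/-- The iterated integrals are the powers of the one-step operator. -/
theorem iteratedIntegral_eq_stepOp_pow {d : ℕ} {T : FellerSemigroup d}
    {p : ℝ≥0 → Kernel (Space d) (Space d)} (hp : IsTransitionKernel T p) (a : Space d →ᵇ ℝ≥0)
    (b : Space d →ᵇ Space d) (V : Space d →ᵇ ℝ) (f : CInf d) (τ : ℝ≥0) (n : ℕ) (q₀ : Space d) :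
    iteratedIntegral (shiftedKernel p a b τ) n
      (fun q => Complex.exp ((τ : ℂ) * ∑ k : Fin n, (V (q k.castSucc) : ℂ)) * f (q (Fin.last n)))
      q₀ = (stepOp T a b V τ ^ n) f q₀ := by
  induction n generalizing q₀ with
  | zero => simp [iteratedIntegral]
  | succ n ih =>
    have e : ∀ path : Fin (n + 1) → Space d,
        Complex.exp ((τ : ℂ) * ∑ k : Fin (n + 1),
            (V ((Fin.cons q₀ path : Fin (n + 2) → Space d) k.castSucc) : ℂ)) *
          f ((Fin.cons q₀ path : Fin (n + 2) → Space d) (Fin.last (n + 1)))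
        = Complex.exp ((τ : ℂ) * (V q₀ : ℂ)) *
          (Complex.exp ((τ : ℂ) * ∑ k : Fin n, (V (path k.castSucc) : ℂ)) *
            f (path (Fin.last n))) := by
      intro path
      -- The summand V(q₀) is constant under the integrals and is the potential factor of the
      -- outermost step; the rest is the same integrand for the path started at q₁.
      rw [Fin.sum_univ_succ, mul_add, Complex.exp_add, mul_assoc]
      simp only [← Fin.succ_last, Fin.castSucc_zero, Fin.cons_zero, Fin.cons_succ,
        ← Fin.succ_castSucc]
    simp only [iteratedIntegral, e, iteratedIntegral_const_mul, ih]
    rw [integral_const_mul, pow_succ']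
    change _ = stepOp T a b V τ ((stepOp T a b V τ ^ n) f) q₀
    rw [stepOp_apply, hp.2]
    rfl

theorem lagrangianIntegral_eq {d : ℕ} {T : FellerSemigroup d}
    {p : ℝ≥0 → Kernel (Space d) (Space d)} (hp : IsTransitionKernel T p) (a : Space d →ᵇ ℝ≥0)
    (b : Space d →ᵇ Space d) (V : Space d →ᵇ ℝ) (f : CInf d) (t : ℝ≥0) (n : ℕ) (q₀ : Space d) :
    lagrangianIntegral p a b V f t n q₀ = (stepOp T a b V (t / n) ^ n) f q₀ :=
  iteratedIntegral_eq_stepOp_pow hp a b V f (t / n) n q₀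

end IteratedIntegral

/-! ### Consistency of the step with B, and the main theorem. -/

theorem consistentOn_stepOp {d : ℕ} {H : Space d → Space d → ℂ} {T : FellerSemigroup d}
    (hHdom : (psiDO H).domain = testFunctions d) (hHT : -psiDO H ≤ T.generator)
    {c : ℝ≥0} (hc : 0 < c) {a : Space d →ᵇ ℝ≥0} (ha : ∀ q, c ≤ a q ∧ a q ≤ 1 / c)
    (b : Space d →ᵇ Space d) (V : Space d →ᵇ ℝ) (hcl : (-psiDO (mulSymbol a H)).IsClosable) :
    ConsistentOn (stepOp T a b V)
      ((perturbedOp (mulSymbol a H) b V).graph : Set (CInf d × CInf d)) := by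
  rintro x hx
  obtain ⟨y, hy1, hy2⟩ := (LinearPMap.mem_graph_iff _).1 hx
  obtain ⟨⟨hyA, hyG⟩, hyV⟩ := y.2
  obtain ⟨g, hg, hg'⟩ := exists_mem_of_mem_closure_graph hHdom T.isClosed_generatorGraph
    (by rw [← T.generator_graph]; exact LinearPMap.le_graph_of_le hHT) hc (fun q => (ha q).1) hcl
    (LinearPMap.mem_graph _ ⟨(y : CInf d), hyA⟩)
  have h := tendsto_stepOp_diffQuotient V
    (tendsto_timeChangeOp_diffQuotient T a (fun q => (ha q).2) hg hg')
    (tendsto_shiftOp_diffQuotient b ⟨(y : CInf d), hyG⟩)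
  rw [← hy1, ← hy2]
  exact h

end FeynmanFormula

theorem corollary5p3 (d : ℕ)
    (H : Space d → Space d → ℂ) (hH : IsNegativeDefiniteSymbol H)
    (T : FellerSemigroup d)
    (hHdom : (psiDO H).domain = testFunctions d)
    (hHT : -psiDO H ≤ T.generator)
    (p : ℝ≥0 → Kernel (Space d) (Space d)) (hp : IsTransitionKernel T p)
    (c : ℝ≥0) (hc : 0 < c)
    (a : Space d →ᵇ ℝ≥0) (ha : ∀ q, c ≤ a q ∧ a q ≤ 1 / c)
    (b : Space d →ᵇ Space d) (V : Space d →ᵇ ℝ)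
    (hHt : ∃ Tt : C0Semigroup (CInf d), ClosureGenerates (-psiDO (mulSymbol a H)) Tt)
    (D : Submodule ℂ (CInf d)) (TB : C0Semigroup (CInf d))
    (hB : ClosureGenerates ((perturbedOp (mulSymbol a H) b V).domRestrict D) TB)
    (f : CInf d) (t₀ : ℝ≥0) :
    TendstoUniformlyOn (fun (n : ℕ) (t : ℝ≥0) => (stepOp T a b V (t / n) ^ n) f)
        (fun t => TB.op t f) atTop (Set.Icc 0 t₀) ∧
      TendstoUniformlyOn
        (fun (n : ℕ) (x : ℝ≥0 × Space d) => lagrangianIntegral p a b V f x.1 n x.2)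
        (fun x => TB.op x.1 f x.2) atTop (Set.Icc 0 t₀ ×ˢ Set.univ) := by
  obtain ⟨Tt, hcl, -⟩ := hHt
  have hF := consistentOn_stepOp hHdom hHT hc ha b V hcl
  -- Restriction to `D` only shrinks the graph, so consistency on the unrestricted B suffices for
  -- every `D`.
  have hG : (TB.generatorGraph : Set (CInf d × CInf d))
      ⊆ closure ((perturbedOp (mulSymbol a H) b V).graph : Set (CInf d × CInf d)) := by
    rw [← TB.generator_graph, ← hB.2, ← hB.1.graph_closure_eq_closure_graph]
    exact closure_mono (LinearPMap.le_graph_of_le LinearPMap.domRestrict_le)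
  have main := hF.tendstoUniformlyOn_pow hG (stepOp_zero T a b V) (norm_nonneg V)
    (norm_stepOp_le T a b V) f t₀
  refine ⟨main, ?_⟩
  -- The supremum norm dominates point values, which gives uniformity in q₀.
  rw [Metric.tendstoUniformlyOn_iff] at main ⊢
  intro ε hε
  filter_upwards [main ε hε] with n hn x hx
  rw [lagrangianIntegral_eq hp, dist_eq_norm, ← ZeroAtInftyContinuousMap.sub_apply]
  refine (norm_apply_le _ x.2).trans_lt ?_
  rw [← dist_eq_norm]
  exact hn x.1 hx.1
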